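/- For $n\ge 1$ and $0<\varepsilon\le 1$ let $C^n(\varepsilon)\subseteq\mathbb R^n$ be the set of all $x$ with $$\varepsilon|x_k|\ \le\ \frac{2^{\binom k2}}{\varepsilon^{k-1}}-(-1)^k\sum_{j=1}^{k-1}\binom{k-2}{j-1}x_j\qquad(1\le k\le n),$$ and for $n\ge d\ge 2$ let $C_d^n=C_d^n(\varepsilon)\subseteq\mathbb R^d$ be the image of $C^n(\varepsilon)$ under the projection $(x_1,\dots,x_n)\mapsto(x_{n-d+1},\dots,x_n)$ to the last $d$ coordinates. Let $f_k(P)$ denote the number of $k$-dimensional faces of a polytope $P$. A polytope is cubical if each of its nonempty proper faces has face poset isomorphic to that of some standard cube $[0,1]^k$. For all $n\ge d\ge 2$ and all sufficiently small $\varepsilon>0$ (depending on $n$ and $d$), $C_d^n$ is a cubical $d$-polytope, and its number of facets $f(n,d):=f_{d-1}(C_d^n)$ is $$f(n,d)=2d+4\sum_{p=0}^{n-d-1}\left(\binom{\lfloor\frac d2\rfloor+p+1}{p+2}+\binom{\lfloor\frac{d+1}2\rfloor+p}{p+2}\right)2^p$$ $$=2d+\sum_{p=2}^{n-d+1}\left(\binom{\lfloor\frac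 d2\rfloor+p-1}{p}+\binom{\lfloor\frac{d-1}2\rfloor+p-1}{p}\right)2^p,$$ that is, $$f(n,d)=2d+\sum_{p=2}^{n-d+1}\frac{p+2k-2}{p+k-1}\binom{k+p-1}{p}2^p\quad\text{if } d=2k,$$ $$f(n,d)=2d+\sum_{p=2}^{n-d+1}\binom{k+p-1}{p}2^{p+1}\quad\text{if } d=2k+1.$$ In particular, for every $n\ge4$ and all sufficiently small $\varepsilon>0$, the cubical $4$-polytope $C_4^n$ has $f_0=2^n$ vertices and $f_3=f(n,4)=(n-2)2^{n-2}$ facets, so that $f_3/f_0=\frac14\log_2\frac{f_0}4$. Consequently the facet/vertex ratio $f_3/f_0$ is unbounded on the class of cubical $4$-polytopes: for every real $R$ there is a cubical $4$-polytope $P$ with $f_3(P)/f_0(P)>R$. This answers the question of Kalai, Perles and Stanley. -/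

import Mathlib

open scoped BigOperators

noncomputable section

namespace CubicalPolytope

section Polytopes

variable {E F : Type*} [NormedAddCommGroup E] [NormedSpace ℝ E]
  [NormedAddCommGroup F] [NormedSpace ℝ F]

/-- A convex polytope: the convex hull of finitely many points. -/
def IsPolytope (P : Set E) : Prop :=
  ∃ s : Set E, s.Finite ∧ P = convexHull ℝ s

/-- The poset (under inclusion) of all faces of `P`, including the empty face and `P` itself.
A face is the empty set or the set of maximizers over `P` of a linear functional. -/
abbrev FacePoset (P : Set E) : Type _ := {G : Set E // IsExposed ℝ P G}

/-- Combinatorial equivalence: isomorphic face posets. -/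
def CombEquiv (P : Set E) (Q : Set F) : Prop :=
  Nonempty (FacePoset P ≃o FacePoset Q)

/-- The affine dimension of a (nonempty) set. -/
def affDim (P : Set E) : ℕ := Module.finrank ℝ (vectorSpan ℝ P)

/-- The number `f_k(P)` of `k`-dimensional faces of `P`. -/
def numFaces (k : ℕ) (P : Set E) : ℕ :=
  Set.ncard {G : Set E | IsExposed ℝ P G ∧ G.Nonempty ∧ affDim G = k}

/-- A combinatorial `k`-cube: a polytope combinatorially equivalent to `[0,1]^k`. -/
def IsCombinatorialCube (k : ℕ) (P : Set E) : Prop :=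
  IsPolytope P ∧ CombEquiv P (Set.Icc (0 : Fin k → ℝ) 1)

/-- A cubical `d`-polytope: a nonempty polytope of dimension `d`, all of whose (nonempty) proper
faces are combinatorial cubes. -/
def IsCubicalPolytope (d : ℕ) (P : Set E) : Prop :=
  IsPolytope P ∧ P.Nonempty ∧ affDim P = d ∧
    ∀ G : Set E, IsExposed ℝ P G → G.Nonempty → G ≠ P → ∃ k : ℕ, IsCombinatorialCube k G

end Polytopes

/-- The deformed cube `C^n(ε) ⊆ ℝ^n`, the set of `x` with
`ε |x_k| ≤ 2^(k choose 2) / ε^(k-1) - (-1)^k ∑_{j=1}^{k-1} (k-2 choose j-1) x_j` for `1 ≤ k ≤ n`.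
The coordinates are numbered from `0` here, so that `k = i + 1` and the summation index `j` of the
formula is one more than the one below. -/
def deformedCube (n : ℕ) (ε : ℝ) : Set (Fin n → ℝ) :=
  {x | ∀ i : Fin n,
    ε * |x i| ≤ 2 ^ Nat.choose ((i : ℕ) + 1) 2 / ε ^ (i : ℕ) -
      (-1) ^ ((i : ℕ) + 1) * ∑ j ∈ Finset.Iio i, (Nat.choose ((i : ℕ) - 1) (j : ℕ) : ℝ) * x j}

/-- The projection `ℝ^n → ℝ^d` to the last `d` coordinates. -/
def lastCoords {n d : ℕ} (h : d ≤ n) : (Fin n → ℝ) →ₗ[ℝ] (Fin d → ℝ) :=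
  LinearMap.funLeft ℝ ℝ (fun i : Fin d => (⟨n - d + (i : ℕ), by omega⟩ : Fin n))

/-- The polytope `C_d^n = C_d^n(ε)`, the image of the deformed cube `C^n(ε)` under the projection
to the last `d` coordinates. -/
def neighborlyCubical {n d : ℕ} (h : d ≤ n) (ε : ℝ) : Set (Fin d → ℝ) :=
  lastCoords h '' deformedCube n ε

end CubicalPolytope

end

/-! Everything is read off from the facet normals of the deformed cube. Their matrix is lower
triangular with diagonal entries `±ε`, so every choice of one sign per index gives a vertex and
every linear functional is a nonnegative combination of normals with distinct indices. This is the
content of `CubeSystem`; it makes the deformed cube a combinatorial cube whose nonempty faces are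
the partial sign vectors `w`.

A functional on `ℝ^n` factors through the projection to the last `d` coordinates exactly when its
first `m = n - d` coefficients vanish. Hence the nonempty faces of `C_d^n` are the images of those
faces `w` whose normals, truncated to `m` coordinates, have a dependence with strictly positive
coefficients (`exists_eq_projectedFace`, `HasPositiveDependence.isExposed`), and distinct such `w`
give distinct images. If any `m` truncated normals with distinct indices are independent, the
projection is injective on every such face with nonempty `w`. Its image is then again a cube of the
same dimension, which gives cubicality and reduces face counting to counting sign vectors
(`InGeneralPosition.isCubicalPolytope`, `InGeneralPosition.numFaces_eq`).

For small `ε` the truncated minors have known signs. Rows of an initial block contribute their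
diagonal sign, and what remains is close to a Pascal minor with rows signed by parity
(`det_choose_pos`, `eventually_minor_pos`). By Cramer's rule, `m + 1` rows are positively dependent
iff consecutive maximal minors alternate in sign, which becomes a Gale evenness condition on
parities and signs (`HasStableMinors.hasPositiveDependence_iff`).

Facets are the solutions of that condition. Splitting by the length of the initial block reduces
their number to the count of parity-alternating sequences (`ncard_galeSet`). Vertices are the full
sign vectors, and all `2^n` of them satisfy the dependence condition (`HasStableMinors.ncard_full`).
For `d = 4` the facet sum telescopes, so the facet/vertex ratio is `(n - 2) / 4`. -/

noncomputable section

namespace CubicalPolytope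

/-! ### Polytopes described by cube-like systems of slacks -/

section CubeSystem

variable {E F : Type*} [NormedAddCommGroup E] [NormedSpace ℝ E]
  [NormedAddCommGroup F] [NormedSpace ℝ F] {ι : Type*} [Fintype ι]

/-- The subset of `P` on which the slacks `u i b` selected by the partial sign vector `w` vanish. -/
def cubeFace (P : Set E) (u : ι → Bool → E → ℝ) (w : ι → Option Bool) : Set E :=
  {x | x ∈ P ∧ ∀ i b, w i = some b → u i b x = 0}

/-- The partial sign vector with support that of `μ` and with signs given by `σ`. -/
def signedSupport (μ : ι → ℝ) (σ : ι → Bool) : ι → Option Bool :=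
  fun i => if μ i = 0 then none else some (σ i)

/-- A description of the convex set `P` by slacks `u i b`, two for each `i : ι`, that makes it a
combinatorial cube: opposite slacks do not vanish together, each choice of signs is realized by a
vertex, and every linear functional is bounded by a combination of slacks of distinct indices. -/
structure CubeSystem (P : Set E) (u : ι → Bool → E → ℝ) : Prop where
  convex : Convex ℝ P
  affine : ∀ i s, ∃ (l : E →L[ℝ] ℝ) (κ : ℝ), ∀ x ∈ P, u i s x = κ - l x
  nonneg : ∀ x ∈ P, ∀ i s, 0 ≤ u i s x
  exists_vertex : ∀ σ : ι → Bool, ∃ x ∈ P, ∀ i, u i (σ i) x = 0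
  ne_zero : ∀ x ∈ P, ∀ i s, u i s x = 0 → u i (!s) x ≠ 0
  exists_rep : ∀ (c : E →L[ℝ] ℝ) (S : Set ι) (σ₀ : ι → Bool),
    ∃ (σ : ι → Bool) (μ : ι → ℝ) (κ : ℝ), (∀ i ∈ S, σ i = σ₀ i) ∧ (∀ i ∉ S, 0 ≤ μ i) ∧
      ∀ x ∈ P, c x = κ - ∑ i, μ i * u i (σ i) x

namespace CubeSystem

variable {P : Set E} {u : ι → Bool → E → ℝ}

theorem nonempty (h : CubeSystem P u) : P.Nonempty :=
  let ⟨x, hx, _⟩ := h.exists_vertex fun _ => true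
  ⟨x, hx⟩

theorem exists_mem_cubeFace (h : CubeSystem P u) {w : ι → Option Bool} {σ : ι → Bool}
    (hσ : ∀ i b, w i = some b → σ i = b) :
    ∃ x ∈ cubeFace P u w, ∀ i, u i (σ i) x = 0 := by
  obtain ⟨x, hx, hx0⟩ := h.exists_vertex σ
  exact ⟨x, ⟨hx, fun i b hb => hσ i b hb ▸ hx0 i⟩, hx0⟩

theorem cubeFace_nonempty (h : CubeSystem P u) (w : ι → Option Bool) :
    (cubeFace P u w).Nonempty := by
  obtain ⟨x, hx, -⟩ := h.exists_mem_cubeFace (w := w) (σ := fun i => (w i).getD true)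
    (by intro i b hb; simp [hb])
  exact ⟨x, hx⟩

theorem eq_of_eq_zero (h : CubeSystem P u) {x : E} (hx : x ∈ P) {i : ι} {a b : Bool}
    (ha : u i a x = 0) (hb : u i b x = 0) : a = b := by
  by_contra hab
  have : b = !a := by cases a <;> cases b <;> simp_all
  exact h.ne_zero x hx i a ha (this ▸ hb)

/-- A functional with a nonnegative representation by slacks attains its maximum exactly on the face
cut out by the slacks with nonzero coefficients. -/
theorem toExposed_eq_cubeFace (h : CubeSystem P u) {c : E →L[ℝ] ℝ} {σ : ι → Bool} {μ : ι → ℝ}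
    {κ : ℝ} (hμ : ∀ i, 0 ≤ μ i) (hc : ∀ x ∈ P, c x = κ - ∑ i, μ i * u i (σ i) x) :
    {x | x ∈ P ∧ ∀ y ∈ P, c y ≤ c x} = cubeFace P u (signedSupport μ σ) := by
  have hnn : ∀ x ∈ P, ∀ i, 0 ≤ μ i * u i (σ i) x :=
    fun x hx i => mul_nonneg (hμ i) (h.nonneg x hx i _)
  ext x
  constructor
  · rintro ⟨hx, hmax⟩
    refine ⟨hx, fun i b hb => ?_⟩
    obtain ⟨y, hy, hy0⟩ := h.exists_vertex σ
    have h1 := hmax y hy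
    rw [hc x hx, hc y hy] at h1
    simp only [hy0, mul_zero, Finset.sum_const_zero, sub_zero] at h1
    have h2 : ∑ i, μ i * u i (σ i) x = 0 :=
      le_antisymm (by linarith) (Finset.sum_nonneg fun i _ => hnn x hx i)
    have h3 := (Finset.sum_eq_zero_iff_of_nonneg fun i _ => hnn x hx i).1 h2 i (Finset.mem_univ i)
    unfold signedSupport at hb
    split_ifs at hb with hi
    simp only [Option.some.injEq] at hb
    subst hb
    exact (mul_eq_zero.1 h3).resolve_left hi
  · rintro ⟨hx, hx0⟩
    refine ⟨hx, fun y hy => ?_⟩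
    rw [hc x hx, hc y hy]
    have : ∑ i, μ i * u i (σ i) x = 0 := by
      refine Finset.sum_eq_zero fun i _ => ?_
      by_cases hi : μ i = 0
      · simp [hi]
      · rw [hx0 i (σ i) (by simp [signedSupport, hi]), mul_zero]
    have := Finset.sum_nonneg fun i (_ : i ∈ Finset.univ) => hnn y hy i
    linarith

theorem isExposed_cubeFace (h : CubeSystem P u) (w : ι → Option Bool) :
    IsExposed ℝ P (cubeFace P u w) := by
  intro _
  choose l κ hl using h.affine
  refine ⟨∑ i, if w i = none then 0 else l i ((w i).getD true), ?_⟩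
  have := h.toExposed_eq_cubeFace
    (c := ∑ i, if w i = none then 0 else l i ((w i).getD true))
    (σ := fun i => (w i).getD true) (μ := fun i => if w i = none then 0 else 1)
    (κ := ∑ i, if w i = none then 0 else κ i ((w i).getD true))
    (fun i => by split_ifs <;> norm_num) (by
      intro x hx
      rw [← Finset.sum_sub_distrib, sum_apply]
      refine Finset.sum_congr rfl fun i _ => ?_
      split_ifs
      · simp
      · rw [hl i _ x hx]; ring)
  rw [this]
  congr 1
  funext i
  cases hi : w i <;> simp [signedSupport, hi]

theorem exists_eq_cubeFace (h : CubeSystem P u) {G : Set E} (hG : IsExposed ℝ P G)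
    (hne : G.Nonempty) : ∃ w, G = cubeFace P u w := by
  obtain ⟨c, rfl⟩ := hG hne
  obtain ⟨σ, μ, κ, -, hμ, hc⟩ := h.exists_rep c ∅ fun _ => true
  exact ⟨_, h.toExposed_eq_cubeFace (fun i => hμ i (Set.notMem_empty i)) hc⟩

theorem cubeFace_subset_iff (h : CubeSystem P u) {w w' : ι → Option Bool} :
    cubeFace P u w ⊆ cubeFace P u w' ↔ ∀ i b, w' i = some b → w i = some b := by
  constructor
  · intro hsub i b hb
    by_contra hne
    -- A vertex of the face `w` that takes sign `!b` wherever `w` leaves a choice: it avoids the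
    -- facet `(i, b)` unless `w` already prescribes it.
    obtain ⟨x, hx, hx0⟩ := h.exists_mem_cubeFace (w := w) (σ := fun j => (w j).getD (!b))
      (by intro i b hb; simp [hb])
    have h1 := h.eq_of_eq_zero hx.1 ((hsub hx).2 i b hb) (hx0 i)
    cases hi : w i with
    | none => simp [hi] at h1
    | some a => simp [hi] at h1 hne; exact hne h1.symm
  · intro hw x hx
    exact ⟨hx.1, fun i b hb => hx.2 i b (hw i b hb)⟩

theorem cubeFace_injective (h : CubeSystem P u) : Function.Injective (cubeFace P u) := by
  intro w w' hww
  have h1 := h.cubeFace_subset_iff.1 hww.le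
  have h2 := h.cubeFace_subset_iff.1 hww.ge
  funext i
  exact Option.ext fun b => ⟨h2 i b, h1 i b⟩

/-- A functional separating a point of `P` from the hull of the vertices would, by its slack
representation, already be maximal at the vertex of the signs used. -/
theorem isPolytope (h : CubeSystem P u) : IsPolytope P := by
  choose v hv hv0 using h.exists_vertex
  refine ⟨Set.range v, Set.finite_range v, Set.Subset.antisymm (fun x hx => ?_)
    (convexHull_min (Set.range_subset_iff.2 hv) h.convex)⟩
  by_contra hxn
  obtain ⟨c, a, hca, hax⟩ := geometric_hahn_banach_closed_point (convex_convexHull ℝ (Set.range v))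
    ((Set.finite_range v).isClosed_convexHull (𝕜 := ℝ)) hxn
  obtain ⟨σ, μ, κ, -, hμ, hc⟩ := h.exists_rep c ∅ fun _ => true
  have h1 := hca (v σ) (subset_convexHull ℝ _ ⟨σ, rfl⟩)
  rw [hc _ (hv σ)] at h1
  simp only [hv0, mul_zero, Finset.sum_const_zero, sub_zero] at h1
  rw [hc x hx] at hax
  have := Finset.sum_nonneg fun i (_ : i ∈ Finset.univ) =>
    mul_nonneg (hμ i (Set.notMem_empty i)) (h.nonneg x hx i (σ i))
  linarith

/-- The edge vectors from one vertex to its neighbours, each obtained by flipping one sign, form a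
basis of the direction space; the slacks at that vertex serve as dual coordinates. -/
theorem affDim_eq (h : CubeSystem P u) : affDim P = Fintype.card ι := by
  classical
  choose l κ hl using h.affine
  obtain ⟨x₀, hx₀, h0⟩ := h.exists_vertex fun _ => true
  have hv : ∀ i, ∃ x ∈ P, ∀ j, u j (if j = i then false else true) x = 0 :=
    fun i => h.exists_vertex fun j => if j = i then false else true
  choose v hv hv0 using hv
  have hoff : ∀ i j, j ≠ i → u j true (v i) = 0 := fun i j hj => by simpa [hj] using hv0 i j
  have hdiag : ∀ i, u i true (v i) ≠ 0 := fun i =>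
    h.ne_zero (v i) (hv i) i false (by simpa using hv0 i i)
  have hlin : LinearIndependent ℝ fun i => v i - x₀ := by
    rw [Fintype.linearIndependent_iff]
    intro g hg i
    have h1 := congrArg (l i true) hg
    rw [map_sum, map_zero, Finset.sum_eq_single i] at h1
    · have h2 := hl i true _ (hv i)
      have h3 := hl i true _ hx₀
      rw [h0] at h3
      rw [map_smul, map_sub, smul_eq_mul] at h1
      refine (mul_eq_zero.1 h1).resolve_right fun h4 => hdiag i ?_
      linarith
    · intro j _ hj
      have h2 := hl i true _ (hv j)
      rw [hoff j i hj.symm] at h2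
      have h3 := hl i true _ hx₀
      rw [h0] at h3
      rw [map_smul, map_sub, smul_eq_mul]
      have : l i true (v j) - l i true x₀ = 0 := by linarith
      rw [this, mul_zero]
    · simp
  have hspan : vectorSpan ℝ P = Submodule.span ℝ (Set.range fun i => v i - x₀) := by
    apply le_antisymm
    · rw [vectorSpan_eq_span_vsub_set_right ℝ hx₀, Submodule.span_le]
      rintro _ ⟨x, hx, rfl⟩
      have : x -ᵥ x₀ = ∑ i, (u i true x / u i true (v i)) • (v i - x₀) := by
        rw [SeparatingDual.eq_iff_forall_dual_eq (R := ℝ)]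
        intro c
        -- With all signs prescribed, the slacks are those vanishing at `x₀`; no sign condition on
        -- the coefficients is needed here.
        obtain ⟨σ, μ, k, hσ, -, hc⟩ := h.exists_rep c Set.univ fun _ => true
        have hσ' : σ = fun _ => true := funext fun i => hσ i trivial
        subst hσ'
        have hc0 : c x₀ = k := by rw [hc x₀ hx₀]; simp [h0]
        have hcv : ∀ i, c (v i) = k - μ i * u i true (v i) := by
          intro i
          rw [hc _ (hv i), Finset.sum_eq_single i]
          · intro j _ hj; rw [hoff i j hj, mul_zero]
          · simp
        rw [vsub_eq_sub, map_sub, map_sum, hc x hx, hc0, sub_sub_cancel_left,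
          ← Finset.sum_neg_distrib]
        refine Finset.sum_congr rfl fun i _ => ?_
        rw [map_smul, map_sub, hcv, hc0, smul_eq_mul]
        have := hdiag i
        field_simp
        ring
      simp only [SetLike.mem_coe]
      rw [this]
      exact Submodule.sum_mem _ fun i _ =>
        Submodule.smul_mem _ _ (Submodule.subset_span ⟨i, rfl⟩)
    · rw [Submodule.span_le]
      rintro _ ⟨i, rfl⟩
      exact vsub_mem_vectorSpan ℝ (hv i) hx₀
  rw [affDim, hspan, finrank_span_eq_card hlin]

/-- The face of a cube system is again a cube system, indexed by the unused indices. -/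
theorem restrict (h : CubeSystem P u) (w : ι → Option Bool) :
    CubeSystem (cubeFace P u w) fun i : {i // w i = none} => u i.1 := by
  classical
  refine ⟨(h.isExposed_cubeFace w).convex h.convex, fun i s => ?_, fun x hx i s =>
    h.nonneg x hx.1 i.1 s, fun σ => ?_, fun x hx i s => h.ne_zero x hx.1 i.1 s, fun c S σ₀ => ?_⟩
  · obtain ⟨l, κ, hl⟩ := h.affine i.1 s
    exact ⟨l, κ, fun x hx => hl x hx.1⟩
  · obtain ⟨x, hx, hx0⟩ := h.exists_mem_cubeFace (w := w)
      (σ := fun i => if hi : w i = none then σ ⟨i, hi⟩ else (w i).getD true)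
      (by intro i b hb; simp [hb])
    refine ⟨x, hx, fun i => ?_⟩
    simpa [i.2] using hx0 i.1
  -- On indices used by `w` the signs are forced to be those of `w`. Their slacks vanish on the
  -- face, so their coefficients, of arbitrary sign, drop out.
  · obtain ⟨σ, μ, κ, hσ, hμ, hc⟩ := h.exists_rep c
      {i | ∀ hi : w i = none, (⟨i, hi⟩ : {i // w i = none}) ∈ S}
      (fun i => if hi : w i = none then σ₀ ⟨i, hi⟩ else (w i).getD true)
    refine ⟨fun i => σ i.1, fun i => μ i.1, κ, fun i hi => ?_, fun i hi => ?_, fun x hx => ?_⟩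
    · simpa [i.2] using hσ i.1 (fun _ => hi)
    · exact hμ i.1 fun h' => hi (h' i.2)
    · rw [hc x hx.1]
      congr 1
      rw [← Finset.sum_subtype (p := fun i => w i = none) (Finset.univ.filter fun i => w i = none)
        (by simp) fun i => μ i * u i (σ i) x, Finset.sum_filter]
      refine Finset.sum_congr rfl fun i _ => ?_
      split_ifs with hi
      · rfl
      · obtain ⟨b, hb⟩ := Option.ne_none_iff_exists'.1 hi
        have h1 := hσ i (fun h' => absurd h' hi)
        rw [dif_neg hi, hb, Option.getD_some] at h1
        rw [h1, hx.2 i b hb, mul_zero]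

/-- Cube systems are carried along by maps with an affine left inverse. -/
theorem image (h : CubeSystem P u) (π : E →L[ℝ] F) (ρ : F →L[ℝ] E) (a : E)
    (hρ : ∀ x ∈ P, ρ (π x) + a = x) :
    CubeSystem (π '' P) fun i s y => u i s (ρ y + a) := by
  refine ⟨h.convex.linear_image π.toLinearMap, fun i s => ?_, ?_, fun σ => ?_, ?_,
    fun c S σ₀ => ?_⟩
  · obtain ⟨l, κ, hl⟩ := h.affine i s
    refine ⟨l.comp ρ, κ - l a, ?_⟩
    rintro _ ⟨x, hx, rfl⟩
    have := congrArg l (hρ x hx)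
    rw [map_add] at this
    rw [hρ x hx, hl x hx, ContinuousLinearMap.comp_apply]
    linarith
  · rintro _ ⟨x, hx, rfl⟩ i s
    rw [hρ x hx]
    exact h.nonneg x hx i s
  · obtain ⟨x, hx, hx0⟩ := h.exists_vertex σ
    exact ⟨π x, ⟨x, hx, rfl⟩, fun i => by rw [hρ x hx]; exact hx0 i⟩
  · rintro _ ⟨x, hx, rfl⟩ i s
    rw [hρ x hx]
    exact h.ne_zero x hx i s
  · obtain ⟨σ, μ, κ, hσ, hμ, hc⟩ := h.exists_rep (c.comp π) S σ₀
    refine ⟨σ, μ, κ, hσ, hμ, ?_⟩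
    rintro _ ⟨x, hx, rfl⟩
    simp only [hρ x hx]
    exact hc x hx

/-- Reindexing a cube system. -/
theorem reindex {ι' : Type*} [Fintype ι'] (h : CubeSystem P u) (e : ι' ≃ ι) :
    CubeSystem P fun i => u (e i) := by
  refine ⟨h.convex, fun i => h.affine (e i), fun x hx i => h.nonneg x hx (e i), fun σ => ?_,
    fun x hx i => h.ne_zero x hx (e i), fun c S σ₀ => ?_⟩
  · obtain ⟨x, hx, hx0⟩ := h.exists_vertex (σ ∘ e.symm)
    exact ⟨x, hx, fun i => by simpa using hx0 (e i)⟩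
  · obtain ⟨σ, μ, κ, hσ, hμ, hc⟩ := h.exists_rep c (e.symm ⁻¹' S) (σ₀ ∘ e.symm)
    refine ⟨σ ∘ e, μ ∘ e, κ, fun i hi => ?_, fun i hi => hμ _ (by simpa using hi),
      fun x hx => ?_⟩
    · rw [Function.comp_apply, hσ (e i) (by simpa using hi)]; simp
    · rw [hc x hx, ← e.sum_comp]; rfl

/-- The sets of sign vectors that are the vertex sets of the faces of a cube. -/
abbrev SignFaces (ι : Type*) : Type _ :=
  {T : Set (ι → Bool) // T = ∅ ∨ ∃ w : ι → Option Bool, T = {σ | ∀ i b, w i = some b → σ i = b}}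

/-- A face is determined by the sign vectors of its vertices, and the resulting poset depends on `ι`
alone. Comparing with the standard cube then needs only a slack system for each. -/
theorem nonempty_facePoset_orderIso (h : CubeSystem P u) :
    Nonempty (FacePoset P ≃o SignFaces ι) := by
  choose v hv hv0 using h.exists_vertex
  have hmem : ∀ w σ, v σ ∈ cubeFace P u w ↔ ∀ i b, w i = some b → σ i = b := by
    intro w σ
    constructor
    · intro hσ i b hb
      exact h.eq_of_eq_zero (hv σ) (hv0 σ i) (hσ.2 i b hb)
    · intro hσ
      exact ⟨hv σ, fun i b hb => hσ i b hb ▸ hv0 σ i⟩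
  let f : FacePoset P → SignFaces ι := fun G => ⟨{σ | v σ ∈ G.1}, by
    rcases Set.eq_empty_or_nonempty G.1 with h0 | h0
    · left; simp [h0]
    · right
      obtain ⟨w, hw⟩ := h.exists_eq_cubeFace G.2 h0
      exact ⟨w, by ext σ; rw [Set.mem_ofPred_eq, hw, hmem, Set.mem_ofPred_eq]⟩⟩
  have hf : ∀ G G', f G ≤ f G' ↔ G ≤ G' := by
    intro G G'
    constructor
    · intro hle
      change G.1 ⊆ G'.1
      rcases Set.eq_empty_or_nonempty G.1 with h0 | h0
      · rw [h0]; exact Set.empty_subset _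
      obtain ⟨w, hw⟩ := h.exists_eq_cubeFace G.2 h0
      have hne : G'.1.Nonempty := ⟨v fun i => (w i).getD true, hle (by
        change v _ ∈ G.1
        rw [hw, hmem]; intro i b hb; simp [hb])⟩
      obtain ⟨w', hw'⟩ := h.exists_eq_cubeFace G'.2 hne
      rw [hw, hw', h.cubeFace_subset_iff]
      intro i b hb
      have h1 : ∀ σ : ι → Bool, (∀ i b, w i = some b → σ i = b) → σ i = b := fun σ hσ => by
        have : v σ ∈ G'.1 := hle (by change v σ ∈ G.1; rwa [hw, hmem])
        rw [hw', hmem] at this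
        exact this i b hb
      have h2 := h1 (fun i => (w i).getD (!b)) (by intro i b hb; simp [hb])
      cases hi : w i with
      | none => simp [hi] at h2
      | some a => simpa [hi] using h2
    · intro hle σ hσ
      exact hle hσ
  refine ⟨RelIso.ofSurjective (OrderEmbedding.ofMapLEIff f hf) ?_⟩
  rintro ⟨T, rfl | ⟨w, rfl⟩⟩
  · exact ⟨⟨∅, isExposed_empty⟩, Subtype.ext (by simp [f])⟩
  · exact ⟨⟨_, h.isExposed_cubeFace w⟩, Subtype.ext (by
      ext σ; exact hmem w σ)⟩

end CubeSystem

theorem cubeSystem_Icc (k : ℕ) : CubeSystem (Set.Icc (0 : Fin k → ℝ) 1)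
    fun i s x => if s then 1 - x i else x i := by
  refine ⟨convex_Icc _ _, fun i s => ?_, fun x hx i s => ?_, fun σ => ?_, fun x hx i s => ?_,
    fun c S σ₀ => ?_⟩
  · cases s
    · exact ⟨-ContinuousLinearMap.proj i, 0, fun x _ => by simp⟩
    · exact ⟨ContinuousLinearMap.proj i, 1, fun x _ => by simp⟩
  · have h0 := hx.1 i
    have h1 := hx.2 i
    simp only [Pi.zero_apply, Pi.one_apply] at h0 h1
    split_ifs <;> linarith
  · refine ⟨fun i => if σ i then 1 else 0, ⟨fun i => ?_, fun i => ?_⟩, fun i => ?_⟩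
    · dsimp; split_ifs <;> norm_num
    · dsimp; split_ifs <;> norm_num
    · dsimp; split_ifs <;> norm_num
  · cases s <;> simp <;> intro h <;> linarith
  · classical
    have hc : ∀ x, c x = ∑ i, x i * c (Pi.single i 1) := by
      intro x
      conv_lhs => rw [pi_eq_sum_univ' x]
      simp [map_sum, map_smul]
    let σ : Fin k → Bool := fun i => if i ∈ S then σ₀ i else decide (0 ≤ c (Pi.single i 1))
    refine ⟨σ, fun i => (if σ i then 1 else -1) * c (Pi.single i 1),
      ∑ i, if σ i then c (Pi.single i 1) else 0, fun i hi => if_pos hi, fun i hi => ?_,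
      fun x _ => ?_⟩
    · by_cases h0 : 0 ≤ c (Pi.single i 1)
      · simp [σ, hi, h0]
      · simp [σ, hi, h0]; linarith
    · rw [hc, ← Finset.sum_sub_distrib]
      refine Finset.sum_congr rfl fun i _ => ?_
      cases hs : σ i <;> simp only [hs, if_true, if_false, Bool.false_eq_true] <;> ring

theorem CubeSystem.isCombinatorialCube {P : Set E} {u : ι → Bool → E → ℝ}
    (h : CubeSystem P u) : IsCombinatorialCube (Fintype.card ι) P := by
  refine ⟨h.isPolytope, ?_⟩
  obtain ⟨e⟩ := h.nonempty_facePoset_orderIso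
  obtain ⟨e'⟩ := ((cubeSystem_Icc (Fintype.card ι)).reindex
    (Fintype.equivFin ι)).nonempty_facePoset_orderIso
  exact ⟨e.trans e'.symm⟩

end CubeSystem

/-! ### The deformed cube is a combinatorial cube -/

section

/-- The real number `1` or `-1` encoded by a Boolean. -/
def sgn (b : Bool) : ℝ := if b then 1 else -1

@[simp] theorem sgn_true : sgn true = 1 := rfl

@[simp] theorem sgn_false : sgn false = -1 := rfl

theorem sgn_mul_self (b : Bool) : sgn b * sgn b = 1 := by cases b <;> norm_num

theorem sgn_ne_zero (b : Bool) : sgn b ≠ 0 := by cases b <;> norm_num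

/-- The coefficient of `x j` in the facet inequality of the deformed cube with number `i` and
sign `b`. -/
def facetCoeff (ε : ℝ) (b : Bool) (i j : ℕ) : ℝ :=
  if j < i then (-1) ^ (i + 1) * (Nat.choose (i - 1) j : ℝ) else if j = i then sgn b * ε else 0

/-- The undeformed part of the right-hand side of the facet inequalities. -/
def facetBound (ε : ℝ) (i : ℕ) : ℝ := 2 ^ Nat.choose (i + 1) 2 / ε ^ i

/-- The deformation term of the facet inequalities. -/
def deformation {n : ℕ} (i : Fin n) (x : Fin n → ℝ) : ℝ :=
  (-1) ^ ((i : ℕ) + 1) * ∑ j ∈ Finset.Iio i, (Nat.choose ((i : ℕ) - 1) (j : ℕ) : ℝ) * x j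

/-- The slack of a facet inequality of the deformed cube. -/
def facetSlack {n : ℕ} (ε : ℝ) (i : Fin n) (b : Bool) (x : Fin n → ℝ) : ℝ :=
  facetBound ε i - ∑ j : Fin n, facetCoeff ε b i j * x j

variable {n : ℕ} {ε : ℝ}

theorem facetCoeff_self (b : Bool) (i : ℕ) : facetCoeff ε b i i = sgn b * ε := by
  simp [facetCoeff]

theorem facetCoeff_of_lt (b : Bool) {i j : ℕ} (h : i < j) : facetCoeff ε b i j = 0 := by
  simp [facetCoeff, h.not_gt, h.ne']

theorem sum_facetCoeff_mul (b : Bool) (i : Fin n) (x : Fin n → ℝ) :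
    ∑ j : Fin n, facetCoeff ε b i j * x j = sgn b * ε * x i + deformation i x := by
  have h1 : ∀ j : Fin n, facetCoeff ε b i j * x j = (if j = i then sgn b * ε * x i else 0) +
      (if j ∈ Finset.Iio i then (-1) ^ ((i : ℕ) + 1) * ((Nat.choose ((i : ℕ) - 1) (j : ℕ) : ℝ) * x j)
        else 0) := by
    intro j
    rcases lt_trichotomy j i with h | h | h
    · simp [facetCoeff, h, h.ne, mul_assoc]
    · subst h; simp [facetCoeff]
    · have h' : (i : ℕ) < j := h
      simp [facetCoeff_of_lt b h', h.ne', h.le]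
  rw [Finset.sum_congr rfl fun j _ => h1 j, Finset.sum_add_distrib, Finset.sum_ite_eq',
    Finset.sum_ite_mem, Finset.univ_inter]
  simp [deformation, Finset.mul_sum]

theorem facetSlack_eq (i : Fin n) (b : Bool) (x : Fin n → ℝ) :
    facetSlack ε i b x = facetBound ε i - deformation i x - sgn b * (ε * x i) := by
  rw [facetSlack, sum_facetCoeff_mul]; ring

theorem mem_deformedCube_iff (hε : 0 < ε) {x : Fin n → ℝ} :
    x ∈ deformedCube n ε ↔ ∀ i b, 0 ≤ facetSlack ε i b x := by
  refine forall_congr' fun i => ?_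
  rw [Bool.forall_bool, facetSlack_eq, facetSlack_eq, ← abs_of_pos hε, ← abs_mul, abs_of_pos hε,
    abs_le]
  change (-(facetBound ε i - deformation i x) ≤ _ ∧ _ ≤ facetBound ε i - deformation i x) ↔ _
  simp only [sgn_false, sgn_true]
  constructor <;> rintro ⟨h1, h2⟩ <;> constructor <;> linarith

/-- The deformation never closes the gap between opposite facets. Inductively, earlier coordinates
are smaller than `2 * facetBound ε j / ε`, which for `ε ≤ 1` is largest at `j = k = i - 1`. The
binomial weights sum to `2 ^ k`, and `C(k+1, 2) + k + 1 = C(k+2, 2)` gives exactly the next bound;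
this is why the right-hand sides grow as they do. -/
theorem abs_deformation_lt (hε : 0 < ε) (hε1 : ε ≤ 1) (x : Fin n → ℝ) (i : Fin n)
    (hx : ∀ j < i, ε * |x j| ≤ facetBound ε j - deformation j x) :
    |deformation i x| < facetBound ε i := by
  induction i using WellFoundedLT.induction with
  | ind i ih =>
  have hpos : ∀ k, 0 < facetBound ε k := fun k => by unfold facetBound; positivity
  rcases Nat.eq_zero_or_pos i with h0 | h0
  · have : Finset.Iio i = ∅ := by
      ext j; simp [Fin.le_def, h0]
    simpa [deformation, this] using hpos i
  obtain ⟨k, hk⟩ := Nat.exists_eq_add_of_lt h0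
  rw [zero_add] at hk
  set ρ : ℝ := 2 * (2 ^ Nat.choose (k + 1) 2 / ε ^ (k + 1)) with hρ
  have hxj : ∀ j < i, |x j| < ρ := by
    intro j hj
    have h1 := ih j hj fun l hl => hx l (hl.trans hj)
    have h2 := hx j hj
    have h3 : ε * |x j| < 2 * facetBound ε j := by
      have := neg_abs_le (deformation j x); linarith
    have hjk : (j : ℕ) ≤ k := by have : (j : ℕ) < i := hj; omega
    have h4 : |x j| < 2 * (2 ^ Nat.choose (j + 1) 2 / ε ^ ((j : ℕ) + 1)) := by
      rw [← mul_lt_mul_iff_right₀ hε]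
      refine h3.trans_eq ?_
      unfold facetBound
      field_simp
      ring
    refine h4.trans_le ?_
    rw [hρ]
    gcongr 2 * (?_ / ?_)
    · exact pow_le_pow_right₀ (by norm_num) (Nat.choose_le_choose 2 (by omega))
    · exact pow_le_pow_of_le_one hε.le hε1 (by omega)
  have hsum : ∑ j ∈ Finset.Iio i, (Nat.choose ((i : ℕ) - 1) (j : ℕ) : ℝ) = 2 ^ k := by
    have h2 : (2 : ℝ) ^ k = ∑ j ∈ Finset.range (k + 1), (Nat.choose k j : ℝ) := by
      exact_mod_cast (Nat.sum_range_choose k).symm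
    rw [hk, h2, Nat.add_sub_cancel]
    refine Finset.sum_bij (fun j _ => (j : ℕ)) ?_ ?_ ?_ ?_
    · intro j hj
      have : j < i := Finset.mem_Iio.1 hj
      rw [Fin.lt_def] at this
      simp; omega
    · intro a _ b _ h; exact Fin.ext h
    · intro b hb
      have hb' := Finset.mem_range.1 hb
      exact ⟨⟨b, by omega⟩, Finset.mem_Iio.2 (by rw [Fin.lt_def]; simp; omega), rfl⟩
    · intro a _; simp
  calc |deformation i x| = |∑ j ∈ Finset.Iio i, (Nat.choose ((i : ℕ) - 1) (j : ℕ) : ℝ) * x j| := by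
        rw [deformation, abs_mul, abs_pow, abs_neg, abs_one, one_pow, one_mul]
    _ ≤ ∑ j ∈ Finset.Iio i, |(Nat.choose ((i : ℕ) - 1) (j : ℕ) : ℝ) * x j| :=
        Finset.abs_sum_le_sum_abs _ _
    _ < ∑ j ∈ Finset.Iio i, (Nat.choose ((i : ℕ) - 1) (j : ℕ) : ℝ) * ρ := by
        refine Finset.sum_lt_sum_of_nonempty ⟨⟨0, by omega⟩, Finset.mem_Iio.2 h0⟩ fun j hj => ?_
        rw [abs_mul, Nat.abs_cast]
        have hji : j < i := Finset.mem_Iio.1 hj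
        rw [Fin.lt_def] at hji
        have : 0 < Nat.choose ((i : ℕ) - 1) (j : ℕ) := Nat.choose_pos (by omega)
        have := hxj j (Finset.mem_Iio.1 hj)
        gcongr
    _ = facetBound ε i := by
        rw [← Finset.sum_mul, hsum, facetBound, hk, hρ, Nat.choose_succ_succ' (k + 1) 1,
          Nat.choose_one_right, pow_add]
        ring

theorem exists_facetSlack_eq_zero (hε : 0 < ε) (σ : Fin n → Bool) :
    ∃ x : Fin n → ℝ, ∀ i, facetSlack ε i (σ i) x = 0 := by
  let A : Matrix (Fin n) (Fin n) ℝ := Matrix.of fun i j => facetCoeff ε (σ i) i j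
  have hdet : A.det ≠ 0 := by
    rw [Matrix.det_of_isLowerTriangular]
    · refine Finset.prod_ne_zero_iff.2 fun i _ => ?_
      change facetCoeff ε (σ i) i i ≠ 0
      rw [facetCoeff_self]
      exact mul_ne_zero (sgn_ne_zero _) hε.ne'
    · intro i j hij
      exact facetCoeff_of_lt _ hij
  obtain ⟨x, hx⟩ := (Matrix.mulVec_surjective_iff_isUnit.2
    ((Matrix.isUnit_iff_isUnit_det A).2 hdet.isUnit)) fun i => facetBound ε i
  refine ⟨x, fun i => ?_⟩
  rw [facetSlack, ← congrFun hx i, sub_eq_zero]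
  rfl

theorem mem_deformedCube_of_facetSlack_eq_zero (hε : 0 < ε) (hε1 : ε ≤ 1) {σ : Fin n → Bool}
    {x : Fin n → ℝ} (hx : ∀ i, facetSlack ε i (σ i) x = 0) : x ∈ deformedCube n ε := by
  intro i
  change ε * |x i| ≤ facetBound ε i - deformation i x
  induction i using WellFoundedLT.induction with
  | ind i ih =>
  have h1 := abs_deformation_lt hε hε1 x i ih
  have h2 := hx i
  rw [facetSlack_eq] at h2
  have h3 := le_abs_self (deformation i x)
  rw [← abs_of_pos hε, ← abs_mul, abs_of_pos hε, abs_le]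
  cases hs : σ i <;> rw [hs] at h2 <;> simp only [sgn_true, sgn_false] at h2 <;>
    constructor <;> linarith

/-- The facet normals span all linear functionals, with a free choice of the signs of the facets
outside of `S` that makes their coefficients nonnegative. -/
theorem exists_facetCoeff_rep (hε : 0 < ε) (c : Fin n → ℝ) (S : Set (Fin n))
    (σ₀ : Fin n → Bool) : ∃ (σ : Fin n → Bool) (μ : Fin n → ℝ),
      (∀ i ∈ S, σ i = σ₀ i) ∧ (∀ i ∉ S, 0 ≤ μ i) ∧
      ∀ j : Fin n, c j = ∑ i : Fin n, μ i * facetCoeff ε (σ i) i j := by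
  classical
  -- Back substitution: row `k` has no entries beyond column `k`, so a multiple of it clears the
  -- last coefficient. Its diagonal sign, when free, is that of the coefficient, which makes the
  -- multiplier nonnegative.
  suffices H : ∀ k : ℕ, ∀ c : Fin n → ℝ, (∀ j : Fin n, k ≤ j → c j = 0) →
      ∃ (σ : Fin n → Bool) (μ : Fin n → ℝ), (∀ i ∈ S, σ i = σ₀ i) ∧ (∀ i ∉ S, 0 ≤ μ i) ∧
      (∀ i : Fin n, k ≤ i → μ i = 0) ∧
      ∀ j : Fin n, c j = ∑ i : Fin n, μ i * facetCoeff ε (σ i) i j by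
    obtain ⟨σ, μ, h1, h2, -, h3⟩ := H n c fun j hj => absurd hj (not_le.2 j.2)
    exact ⟨σ, μ, h1, h2, h3⟩
  intro k
  induction k with
  | zero => exact fun c hc => ⟨σ₀, fun _ => 0, fun _ _ => rfl, fun _ _ => le_rfl, fun _ _ => rfl,
      fun j => by simp [hc j]⟩
  | succ k ih =>
  intro c hc
  by_cases hk : k < n
  swap
  · obtain ⟨σ, μ, h1, h2, h3, h4⟩ := ih c fun j hj => absurd j.2 (by omega)
    exact ⟨σ, μ, h1, h2, fun i hi => h3 i (by omega), h4⟩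
  let a : Fin n := ⟨k, hk⟩
  let s : Bool := if a ∈ S then σ₀ a else decide (0 ≤ c a)
  let r : ℝ := sgn s * c a / ε
  obtain ⟨σ, μ, h1, h2, h3, h4⟩ := ih (fun j => c j - r * facetCoeff ε s a j) (by
    intro j hj
    rcases hj.eq_or_lt with h | h
    · have hja : j = a := Fin.ext h.symm
      subst hja
      rw [facetCoeff_self]
      have : r * (sgn s * ε) = (sgn s * sgn s) * c a := by
        simp only [r]; field_simp
      rw [this, sgn_mul_self]; ring
    · rw [hc j h, facetCoeff_of_lt s (show (a : ℕ) < j from h)]; ring)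
  refine ⟨Function.update σ a s, Function.update μ a r, fun i hi => ?_, fun i hi => ?_,
    fun i hi => ?_, fun j => ?_⟩
  · by_cases hia : i = a
    · subst hia; simp [s, hi]
    · rw [Function.update_of_ne hia]; exact h1 i hi
  · by_cases hia : i = a
    · subst hia
      rw [Function.update_self]
      refine div_nonneg ?_ hε.le
      by_cases h0 : 0 ≤ c a
      · simp [s, hi, h0]
      · simp [s, hi, h0]; linarith
    · rw [Function.update_of_ne hia]; exact h2 i hi
  · have hia : i ≠ a := by rintro rfl; simp [a] at hi
    rw [Function.update_of_ne hia]; exact h3 i (by omega)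
  · have h5 := h4 j
    have h6 : ∀ i, Function.update μ a r i * facetCoeff ε (Function.update σ a s i) i j =
        μ i * facetCoeff ε (σ i) i j + if i = a then r * facetCoeff ε s a j else 0 := by
      intro i
      by_cases hia : i = a
      · subst hia; simp [h3 a le_rfl]
      · simp [hia]
    rw [Finset.sum_congr rfl fun i _ => h6 i, Finset.sum_add_distrib, ← h5]
    simp

theorem sum_mul_eq_sub_sum_facetSlack {c μ : Fin n → ℝ} {σ : Fin n → Bool}
    (h : ∀ j : Fin n, c j = ∑ i : Fin n, μ i * facetCoeff ε (σ i) i j) (x : Fin n → ℝ) :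
    ∑ j, c j * x j = ∑ i : Fin n, μ i * facetBound ε i - ∑ i, μ i * facetSlack ε i (σ i) x := by
  rw [← Finset.sum_sub_distrib]
  simp only [h, Finset.sum_mul, facetSlack]
  rw [Finset.sum_comm]
  refine Finset.sum_congr rfl fun i _ => ?_
  rw [mul_sub, sub_sub_cancel, Finset.mul_sum]
  exact Finset.sum_congr rfl fun j _ => by ring

theorem continuousLinearMap_pi_apply (c : (Fin n → ℝ) →L[ℝ] ℝ) (x : Fin n → ℝ) :
    c x = ∑ j, c (Pi.single j 1) * x j := by
  conv_lhs => rw [pi_eq_sum_univ' x]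
  simp [map_sum, map_smul, mul_comm]

theorem cubeSystem_deformedCube (hε : 0 < ε) (hε1 : ε ≤ 1) :
    CubeSystem (deformedCube n ε) (facetSlack ε) := by
  have haff : ∀ (i : Fin n) s, ∃ l : (Fin n → ℝ) →L[ℝ] ℝ, ∀ x,
      facetSlack ε i s x = facetBound ε i - l x := fun i s =>
    ⟨∑ j : Fin n, facetCoeff ε s i j • ContinuousLinearMap.proj j, fun x => by
      simp [facetSlack, sum_apply]⟩
  refine ⟨?_, fun i s => ?_, fun x hx => (mem_deformedCube_iff hε).1 hx, fun σ => ?_,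
    fun x hx i s h0 h1 => ?_, fun c S σ₀ => ?_⟩
  · have : deformedCube n ε = ⋂ (i : Fin n) (b : Bool), {x | 0 ≤ facetSlack ε i b x} := by
      ext x; simp [mem_deformedCube_iff hε]
    rw [this]
    refine convex_iInter fun i => convex_iInter fun b => ?_
    obtain ⟨l, hl⟩ := haff i b
    have : {x | 0 ≤ facetSlack ε i b x} = {x | l x ≤ facetBound ε i} := by
      ext x; simp [hl]
    rw [this]
    exact convex_halfSpace_le l.toLinearMap.isLinear _
  · obtain ⟨l, hl⟩ := haff i s
    exact ⟨l, _, fun x _ => hl x⟩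
  · obtain ⟨x, hx⟩ := exists_facetSlack_eq_zero hε σ
    exact ⟨x, mem_deformedCube_of_facetSlack_eq_zero hε hε1 hx, hx⟩
  · have h2 := abs_deformation_lt hε hε1 x i fun j _ => hx j
    have h3 := le_abs_self (deformation i x)
    rw [facetSlack_eq] at h0 h1
    cases s <;> simp only [Bool.not_false, Bool.not_true, sgn_true, sgn_false] at h0 h1 <;> linarith
  · obtain ⟨σ, μ, h1, h2, h3⟩ := exists_facetCoeff_rep hε (fun j => c (Pi.single j 1)) S σ₀
    refine ⟨σ, μ, ∑ i : Fin n, μ i * facetBound ε i, h1, h2, fun x _ => ?_⟩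
    rw [continuousLinearMap_pi_apply]
    exact sum_mul_eq_sub_sum_facetSlack h3 x

end

/-! ### Faces of the projection and positive dependences -/

section

variable {n d m : ℕ} {ε : ℝ}

/-- The indices at which a partial sign vector is defined. -/
def signSupport (w : Fin n → Option Bool) : Finset (Fin n) :=
  Finset.univ.filter fun i => w i ≠ none

@[simp] theorem mem_signSupport {w : Fin n → Option Bool} {i : Fin n} :
    i ∈ signSupport w ↔ w i ≠ none := by simp [signSupport]

/-- The facet normals selected by `w`, truncated to the first `m` coordinates, have a linear
dependence with positive coefficients. -/
def HasPositiveDependence (m : ℕ) (ε : ℝ) (w : Fin n → Option Bool) : Prop :=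
  ∃ μ : Fin n → ℝ, (∀ i, w i = none → μ i = 0) ∧ (∀ i, w i ≠ none → 0 < μ i) ∧
    ∀ j < m, ∑ i : Fin n, μ i * facetCoeff ε ((w i).getD true) i j = 0

/-- The square matrix of truncated facet normals with numbers `t i` and signs `σ i`. -/
def facetMatrix (ε : ℝ) (σ : Fin m → Bool) (t : Fin m → ℕ) : Matrix (Fin m) (Fin m) ℝ :=
  Matrix.of fun i j => facetCoeff ε (σ i) (t i) j

/-- Truncated to the first `m` coordinates, any `m` facet normals with distinct numbers are linearly
independent. -/
def InGeneralPosition (n m : ℕ) (ε : ℝ) : Prop :=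
  ∀ (σ : Fin m → Bool) (t : Fin m → Fin n), StrictMono t →
    (facetMatrix ε σ fun i => (t i : ℕ)).det ≠ 0

/-- At most `m` rows could be padded to `m` independent ones, forcing all coefficients of the
dependence to vanish. -/
theorem InGeneralPosition.lt_card (h : InGeneralPosition n m ε) (hm : m ≤ n)
    {w : Fin n → Option Bool} (hw : HasPositiveDependence m ε w) (hne : (signSupport w).Nonempty) :
    m < (signSupport w).card := by
  by_contra hle
  rw [not_lt] at hle
  obtain ⟨μ, h0, hpos, hdep⟩ := hw
  obtain ⟨T, hT, hTm⟩ := Finset.exists_superset_card_eq hle (by simpa using hm)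
  let t := T.orderEmbOfFin hTm
  have hvan : ∀ i ∉ T, μ i = 0 := fun i hi => h0 i (by
    by_contra h'; exact hi (hT (mem_signSupport.2 h')))
  have hdet := h (fun i => (w (t i)).getD true) t t.strictMono
  have hz : (fun i => μ (t i)) = 0 := by
    refine Matrix.eq_zero_of_vecMul_eq_zero hdet ?_
    funext j
    rw [Pi.zero_apply, ← hdep j j.2]
    refine Fintype.sum_of_injective t t.injective _ _ (fun i hi => ?_) fun i => rfl
    rw [Finset.range_orderEmbOfFin] at hi
    rw [hvan i (by simpa using hi), zero_mul]
  obtain ⟨i, hi⟩ := hne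
  have hiT : i ∈ Set.range t := by rw [Finset.range_orderEmbOfFin]; exact hT hi
  obtain ⟨k, rfl⟩ := hiT
  exact (hpos _ (mem_signSupport.1 hi)).ne' (congrFun hz k)

/-- This makes the projection injective on faces: `y` is a direction in its kernel that is tangent
to at least `m` facets. -/
theorem InGeneralPosition.eq_zero (h : InGeneralPosition n m ε) (hm : m ≤ n) (σ : Fin n → Bool)
    {T : Finset (Fin n)} (hT : m ≤ T.card) {y : Fin n → ℝ} (hy : ∀ j : Fin n, m ≤ j → y j = 0)
    (hTy : ∀ i ∈ T, ∑ j : Fin n, facetCoeff ε (σ i) i j * y j = 0) : y = 0 := by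
  obtain ⟨T', hT', hTm⟩ := Finset.exists_subset_card_eq hT
  let t := T'.orderEmbOfFin hTm
  have hdet := h (fun i => σ (t i)) t t.strictMono
  have hz : (fun j : Fin m => y (Fin.castLE hm j)) = 0 := by
    refine Matrix.eq_zero_of_mulVec_eq_zero hdet ?_
    funext i
    rw [Pi.zero_apply, ← hTy (t i) (hT' (Finset.orderEmbOfFin_mem T' hTm i))]
    refine Fintype.sum_of_injective (Fin.castLE hm) (Fin.castLE_injective hm) _ _ (fun j hj => ?_)
      fun j => rfl
    rw [hy j, mul_zero]
    by_contra hlt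
    exact hj ⟨⟨j, not_le.1 hlt⟩, rfl⟩
  funext j
  rcases lt_or_ge (j : ℕ) m with hj | hj
  · exact congrFun hz ⟨j, hj⟩
  · exact hy j hj

theorem signedSupport_getD {w : Fin n → Option Bool} {μ : Fin n → ℝ}
    (h0 : ∀ i, w i = none → μ i = 0) (hpos : ∀ i, w i ≠ none → 0 < μ i) :
    signedSupport μ (fun i => (w i).getD true) = w := by
  funext i
  cases hi : w i with
  | none => simp [signedSupport, h0 i hi]
  | some b => simp [signedSupport, (hpos i (by simp [hi])).ne', hi]

@[simp] theorem lastCoords_apply (h : d ≤ n) (x : Fin n → ℝ) (i : Fin d) :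
    lastCoords h x i = x ⟨n - d + i, by omega⟩ := rfl

/-- The projection to the last coordinates as a continuous linear map. -/
def lastCoordsL (h : d ≤ n) : (Fin n → ℝ) →L[ℝ] (Fin d → ℝ) :=
  LinearMap.toContinuousLinearMap (lastCoords h)

@[simp] theorem lastCoordsL_apply (h : d ≤ n) (x : Fin n → ℝ) :
    lastCoordsL h x = lastCoords h x := rfl

theorem lastCoords_single_eq_zero (h : d ≤ n) {j : Fin n} (hj : (j : ℕ) < n - d) :
    lastCoords h (Pi.single j 1) = 0 := by
  funext i
  rw [lastCoords_apply, Pi.single_eq_of_ne, Pi.zero_apply]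
  intro h'
  have := congrArg Fin.val h'
  simp only at this
  omega

theorem exists_functional_comp_lastCoords (h : d ≤ n) {c : Fin n → ℝ}
    (hc : ∀ j : Fin n, (j : ℕ) < n - d → c j = 0) :
    ∃ c' : (Fin d → ℝ) →L[ℝ] ℝ, ∀ x, c' (lastCoords h x) = ∑ j, c j * x j := by
  refine ⟨∑ i : Fin d, c ⟨n - d + i, by omega⟩ • ContinuousLinearMap.proj i, fun x => ?_⟩
  simp only [sum_apply, FunLike.coe_smul, Pi.smul_apply, ContinuousLinearMap.proj_apply,
    smul_eq_mul, lastCoords_apply]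
  refine Fintype.sum_of_injective (fun i : Fin d => (⟨n - d + i, by omega⟩ : Fin n)) ?_ _ _
    (fun j hj => ?_) fun i => rfl
  · intro a b hab
    have := congrArg Fin.val hab
    simp only at this
    exact Fin.ext (by omega)
  · rw [hc j, zero_mul]
    by_contra hlt
    exact hj ⟨⟨j - (n - d), by omega⟩, Fin.ext (by simp; omega)⟩

/-- The image under the projection of a face of the deformed cube. -/
def projectedFace (h : d ≤ n) (ε : ℝ) (w : Fin n → Option Bool) : Set (Fin d → ℝ) :=
  lastCoords h '' cubeFace (deformedCube n ε) (facetSlack ε) w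

theorem projectedFace_nonempty (h : d ≤ n) (hε : 0 < ε) (hε1 : ε ≤ 1) (w : Fin n → Option Bool) :
    (projectedFace h ε w).Nonempty :=
  ((cubeSystem_deformedCube hε hε1).cubeFace_nonempty w).image _

theorem projectedFace_eq_neighborlyCubical (h : d ≤ n) {w : Fin n → Option Bool}
    (hw : signSupport w = ∅) : projectedFace h ε w = neighborlyCubical h ε := by
  rw [projectedFace, neighborlyCubical]
  congr 1
  ext x
  refine ⟨fun hx => hx.1, fun hx => ⟨hx, fun i b hb => ?_⟩⟩
  have : i ∈ signSupport w := by simp [hb]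
  simp [hw] at this

/-- The second conclusion says that no other point of the deformed cube lands in the image of the
face; it is what lets the face be recovered from its image. -/
theorem exposed_image_of_preimage (h : d ≤ n) {c : (Fin d → ℝ) →L[ℝ] ℝ}
    {w : Fin n → Option Bool} (hw : {x | x ∈ deformedCube n ε ∧ ∀ y ∈ deformedCube n ε,
      c (lastCoords h y) ≤ c (lastCoords h x)} = cubeFace (deformedCube n ε) (facetSlack ε) w) :
    {x | x ∈ neighborlyCubical h ε ∧ ∀ y ∈ neighborlyCubical h ε, c y ≤ c x} =
      projectedFace h ε w ∧
    ∀ x ∈ deformedCube n ε, lastCoords h x ∈ projectedFace h ε w →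
      x ∈ cubeFace (deformedCube n ε) (facetSlack ε) w := by
  have key : ∀ x ∈ deformedCube n ε, (∀ y ∈ neighborlyCubical h ε, c y ≤ c (lastCoords h x)) →
      x ∈ cubeFace (deformedCube n ε) (facetSlack ε) w := by
    intro x hx hmax
    rw [← hw]
    exact ⟨hx, fun y hy => hmax _ ⟨y, hy, rfl⟩⟩
  have heq : {x | x ∈ neighborlyCubical h ε ∧ ∀ y ∈ neighborlyCubical h ε, c y ≤ c x} =
      projectedFace h ε w := by
    ext z
    constructor
    · rintro ⟨⟨x, hx, rfl⟩, hmax⟩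
      exact ⟨x, key x hx hmax, rfl⟩
    · rintro ⟨x, hx, rfl⟩
      rw [← hw] at hx
      refine ⟨⟨x, hx.1, rfl⟩, ?_⟩
      rintro _ ⟨y, hy, rfl⟩
      exact hx.2 y hy
  refine ⟨heq, fun x hx hxw => key x hx ?_⟩
  rw [← heq] at hxw
  exact hxw.2

theorem HasPositiveDependence.exists_functional (h : d ≤ n) (hε : 0 < ε) (hε1 : ε ≤ 1)
    {w : Fin n → Option Bool} (hw : HasPositiveDependence (n - d) ε w) :
    ∃ c : (Fin d → ℝ) →L[ℝ] ℝ, {x | x ∈ deformedCube n ε ∧ ∀ y ∈ deformedCube n ε,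
      c (lastCoords h y) ≤ c (lastCoords h x)} =
        cubeFace (deformedCube n ε) (facetSlack ε) w := by
  obtain ⟨μ, h0, hpos, hdep⟩ := hw
  obtain ⟨c, hc⟩ := exists_functional_comp_lastCoords h
    (c := fun j => ∑ i : Fin n, μ i * facetCoeff ε ((w i).getD true) i j) fun j hj => hdep j hj
  refine ⟨c, ?_⟩
  have := (cubeSystem_deformedCube hε hε1).toExposed_eq_cubeFace (c := c.comp (lastCoordsL h))
    (μ := μ) (σ := fun i => (w i).getD true) (κ := ∑ i : Fin n, μ i * facetBound ε i)
    (fun i => by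
      by_cases hi : w i = none
      · exact (h0 i hi).ge
      · exact (hpos i hi).le)
    (fun x _ => (hc x).trans (sum_mul_eq_sub_sum_facetSlack (fun _ => rfl) x))
  rw [signedSupport_getD h0 hpos] at this
  exact this

theorem HasPositiveDependence.isExposed (h : d ≤ n) (hε : 0 < ε) (hε1 : ε ≤ 1)
    {w : Fin n → Option Bool} (hw : HasPositiveDependence (n - d) ε w) :
    IsExposed ℝ (neighborlyCubical h ε) (projectedFace h ε w) := by
  obtain ⟨c, hc⟩ := hw.exists_functional h hε hε1
  exact fun _ => ⟨c, (exposed_image_of_preimage h hc).1.symm⟩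

theorem injOn_projectedFace (h : d ≤ n) (hε : 0 < ε) (hε1 : ε ≤ 1) :
    Set.InjOn (projectedFace h ε) {w : Fin n → Option Bool | HasPositiveDependence (n - d) ε w} := by
  have key : ∀ w w' : Fin n → Option Bool, HasPositiveDependence (n - d) ε w' →
      projectedFace h ε w ⊆ projectedFace h ε w' → cubeFace (deformedCube n ε) (facetSlack ε) w ⊆
        cubeFace (deformedCube n ε) (facetSlack ε) w' := by
    intro w w' hw' hsub x hx
    obtain ⟨c, hc⟩ := hw'.exists_functional h hε hε1
    exact (exposed_image_of_preimage h hc).2 x hx.1 (hsub ⟨x, hx, rfl⟩)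
  intro w hw w' hw' heq
  exact (cubeSystem_deformedCube hε hε1).cubeFace_injective
    ((key w w' hw' heq.le).antisymm (key w' w hw heq.ge))

theorem exists_eq_projectedFace (h : d ≤ n) (hε : 0 < ε) (hε1 : ε ≤ 1) {G : Set (Fin d → ℝ)}
    (hG : IsExposed ℝ (neighborlyCubical h ε) G) (hne : G.Nonempty) :
    ∃ w : Fin n → Option Bool, HasPositiveDependence (n - d) ε w ∧ G = projectedFace h ε w := by
  obtain ⟨c, rfl⟩ := hG hne
  obtain ⟨σ, μ, -, hμ, hc⟩ := exists_facetCoeff_rep hε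
    (fun j => c (lastCoords h (Pi.single j 1))) ∅ fun _ => true
  have hμ' : ∀ i, 0 ≤ μ i := fun i => hμ i (Set.notMem_empty i)
  have hface := (cubeSystem_deformedCube hε hε1).toExposed_eq_cubeFace
    (c := c.comp (lastCoordsL h)) hμ' (κ := ∑ i : Fin n, μ i * facetBound ε i) (σ := σ) (fun x _ => by
      rw [continuousLinearMap_pi_apply]
      exact sum_mul_eq_sub_sum_facetSlack hc x)
  refine ⟨_, ⟨μ, fun i hi => ?_, fun i hi => ?_, fun j hj => ?_⟩,
    (exposed_image_of_preimage h hface).1⟩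
  · by_contra h'
    simp [signedSupport, h'] at hi
  · refine (hμ' i).lt_of_ne' fun h' => hi ?_
    simp [signedSupport, h']
  · have hjn : j < n := by omega
    have h1 := hc ⟨j, hjn⟩
    rw [lastCoords_single_eq_zero h (j := ⟨j, hjn⟩) hj, map_zero] at h1
    rw [h1]
    refine Finset.sum_congr rfl fun i _ => ?_
    by_cases hi : μ i = 0
    · simp [hi]
    · simp [signedSupport, hi]

/-- More than `m` facets meet in the face, so the projection is injective on the common kernel `D`
of their normals. A linear left inverse on `D` carries the slacks of the face over to its image. -/
theorem InGeneralPosition.cubeSystem_projectedFace (h : d ≤ n) (hε : 0 < ε) (hε1 : ε ≤ 1)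
    (hgp : InGeneralPosition n (n - d) ε) {w : Fin n → Option Bool}
    (hw : HasPositiveDependence (n - d) ε w) (hne : (signSupport w).Nonempty) :
    ∃ u : {i // w i = none} → Bool → (Fin d → ℝ) → ℝ, CubeSystem (projectedFace h ε w) u := by
  let D : Submodule ℝ (Fin n → ℝ) :=
    { carrier := {y | ∀ i ∈ signSupport w, ∑ j : Fin n, facetCoeff ε ((w i).getD true) i j * y j = 0}
      add_mem' := fun {a b} ha hb i hi => by
        simp only [Pi.add_apply, mul_add, Finset.sum_add_distrib, ha i hi, hb i hi, add_zero]
      zero_mem' := fun i _ => Finset.sum_eq_zero fun j _ => mul_zero _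
      smul_mem' := fun r a ha i hi => by
        simp only [Pi.smul_apply, smul_eq_mul, mul_left_comm _ r, ← Finset.mul_sum, ha i hi,
          mul_zero] }
  have hinj : LinearMap.ker ((lastCoords h).domRestrict D) = ⊥ := by
    rw [LinearMap.ker_eq_bot']
    rintro ⟨y, hy⟩ hy0
    refine Subtype.ext (hgp.eq_zero (Nat.sub_le n d) (fun i => (w i).getD true)
      (hgp.lt_card (Nat.sub_le n d) hw hne).le (fun j hj => ?_) hy)
    have := congrFun hy0 ⟨j - (n - d), by omega⟩
    simp only [LinearMap.domRestrict_apply, lastCoords_apply, Pi.zero_apply] at this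
    rw [← this]
    exact congrArg y (Fin.ext (Nat.add_sub_cancel' hj).symm)
  obtain ⟨ρ, hρ⟩ := LinearMap.exists_leftInverse_of_injective _ hinj
  have hcs := (cubeSystem_deformedCube (n := n) hε hε1).restrict w
  obtain ⟨x₀, hx₀⟩ := hcs.nonempty
  let ρ' : (Fin d → ℝ) →L[ℝ] (Fin n → ℝ) := LinearMap.toContinuousLinearMap (D.subtype ∘ₗ ρ)
  refine ⟨_, hcs.image (lastCoordsL h) ρ' (x₀ - ρ' (lastCoords h x₀)) fun x hx => ?_⟩
  have hD : x - x₀ ∈ D := by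
    intro i hi
    obtain ⟨b, hb⟩ := Option.ne_none_iff_exists'.1 (mem_signSupport.1 hi)
    have h1 := hx.2 i b hb
    have h2 := hx₀.2 i b hb
    rw [facetSlack] at h1 h2
    simp only [Pi.sub_apply, mul_sub, Finset.sum_sub_distrib, hb, Option.getD_some]
    linarith
  have h1 : ρ' (lastCoords h (x - x₀)) = x - x₀ :=
    congrArg Subtype.val (LinearMap.congr_fun hρ ⟨x - x₀, hD⟩)
  rw [map_sub, map_sub] at h1
  rw [lastCoordsL_apply]
  have h2 : ρ' (lastCoords h x) + (x₀ - ρ' (lastCoords h x₀)) =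
    (ρ' (lastCoords h x) - ρ' (lastCoords h x₀)) + x₀ := by abel
  rw [h2, h1, sub_add_cancel]

theorem affDim_neighborlyCubical (h : d ≤ n) (hε : 0 < ε) (hε1 : ε ≤ 1) :
    affDim (neighborlyCubical h ε) = d := by
  have h1 := (cubeSystem_deformedCube (n := n) hε hε1).affDim_eq
  rw [Fintype.card_fin, affDim] at h1
  have htop : vectorSpan ℝ (deformedCube n ε) = ⊤ :=
    Submodule.eq_top_of_finrank_eq (by rw [h1]; simp)
  have h2 : vectorSpan ℝ (neighborlyCubical h ε) = ⊤ := by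
    have := (lastCoords h).toAffineMap.map_vectorSpan (s := deformedCube n ε)
    change Submodule.map (lastCoords h) _ = vectorSpan ℝ (neighborlyCubical h ε) at this
    rw [← this, htop, Submodule.map_top, LinearMap.range_eq_top]
    refine LinearMap.funLeft_surjective_of_injective ℝ ℝ _ fun a b hab => ?_
    have := congrArg Fin.val hab
    simp only at this
    exact Fin.ext (by omega)
  rw [affDim, h2]
  simp

theorem InGeneralPosition.isCubicalPolytope (h : d ≤ n) (hε : 0 < ε) (hε1 : ε ≤ 1)
    (hgp : InGeneralPosition n (n - d) ε) : IsCubicalPolytope d (neighborlyCubical h ε) := by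
  have hcs := cubeSystem_deformedCube (n := n) hε hε1
  refine ⟨?_, hcs.nonempty.image _, affDim_neighborlyCubical h hε hε1, fun G hG hne hGP => ?_⟩
  · obtain ⟨s, hs, heq⟩ := hcs.isPolytope
    exact ⟨lastCoords h '' s, hs.image _, by
      rw [neighborlyCubical, heq, LinearMap.image_convexHull]⟩
  · obtain ⟨w, hw, rfl⟩ := exists_eq_projectedFace h hε hε1 hG hne
    obtain ⟨u, hu⟩ := hgp.cubeSystem_projectedFace h hε hε1 hw (by
      by_contra h'
      rw [Finset.not_nonempty_iff_eq_empty] at h'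
      exact hGP (projectedFace_eq_neighborlyCubical h h'))
    exact ⟨_, hu.isCombinatorialCube⟩

theorem InGeneralPosition.numFaces_eq (h : d ≤ n) (hε : 0 < ε) (hε1 : ε ≤ 1)
    (hgp : InGeneralPosition n (n - d) ε) {k : ℕ} (hk : k < d) :
    numFaces k (neighborlyCubical h ε) =
      Set.ncard {w : Fin n → Option Bool | (signSupport w).card = n - k ∧
        HasPositiveDependence (n - d) ε w} := by
  have hdim : ∀ w : Fin n → Option Bool, HasPositiveDependence (n - d) ε w →
      (affDim (projectedFace h ε w) = k ↔ (signSupport w).card = n - k) := by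
    intro w hw
    rcases (signSupport w).eq_empty_or_nonempty with h0 | h0
    · rw [projectedFace_eq_neighborlyCubical h h0, affDim_neighborlyCubical h hε hε1, h0, Finset.card_empty]
      omega
    · obtain ⟨u, hu⟩ := hgp.cubeSystem_projectedFace h hε hε1 hw h0
      rw [hu.affDim_eq]
      have h1 := Finset.card_filter_add_card_filter_not (s := Finset.univ) fun i => w i = none
      rw [Finset.card_univ, Fintype.card_fin, ← Fintype.card_subtype] at h1
      change _ + (signSupport w).card = n at h1
      omega
  rw [numFaces, ← ((injOn_projectedFace h hε hε1).mono fun w hw => hw.2).ncard_image]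
  congr 1
  ext G
  constructor
  · rintro ⟨hG, hne, hk⟩
    obtain ⟨w, hw, rfl⟩ := exists_eq_projectedFace h hε hε1 hG hne
    exact ⟨w, ⟨(hdim w hw).1 hk, hw⟩, rfl⟩
  · rintro ⟨w, ⟨hwk, hw⟩, rfl⟩
    exact ⟨hw.isExposed h hε hε1, projectedFace_nonempty h hε hε1 w, (hdim w hw).2 hwk⟩

end

/-! ### Signs of minors of the facet normals -/

/-- Minors of the Pascal matrix with consecutive columns and with rows not above the diagonal are
positive. -/
theorem det_choose_pos {q : ℕ} (a : ℕ) {r : Fin q → ℕ} (hr : StrictMono r) (ha : ∀ i, a ≤ r i) :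
    0 < (Matrix.of fun i j : Fin q => (Nat.choose (r i) (a + j) : ℝ)).det := by
  -- By `C(r, a+j) C(a+j, a) = C(r, a) C(r-a, j)`, positive row and column factors reduce the matrix
  -- to monic polynomials of degree `j` in `r i - a`, whose determinant is Vandermonde.
  have hentry : ∀ i j : Fin q, (Nat.choose (r i) (a + j) : ℝ) = (Nat.choose (r i) a : ℝ) *
      (((Nat.factorial j * Nat.choose (a + j) a : ℕ) : ℝ)⁻¹ *
        (descPochhammer ℝ j).eval ((r i - a : ℕ) : ℝ)) := by
    intro i j
    have h1 := Nat.choose_mul (n := r i) (Nat.le_add_right a j)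
    rw [Nat.add_sub_cancel_left] at h1
    have h2 := Nat.descFactorial_eq_factorial_mul_choose (r i - a) j
    rw [descPochhammer_eval_eq_descFactorial, h2]
    have h3 : ((Nat.choose (r i) (a + j) * Nat.choose (a + j) a : ℕ) : ℝ) =
      ((Nat.choose (r i) a * Nat.choose (r i - a) j : ℕ) : ℝ) := by rw [h1]
    have h4 : (Nat.choose (a + j) a : ℝ) ≠ 0 :=
      Nat.cast_ne_zero.2 (Nat.choose_pos (Nat.le_add_right a j)).ne'
    have h5 : (Nat.factorial j : ℝ) ≠ 0 := Nat.cast_ne_zero.2 (Nat.factorial_ne_zero j)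
    push_cast at h3 ⊢
    field_simp
    linarith
  simp_rw [hentry]
  have h1 := Matrix.det_mul_column (fun i : Fin q => (Nat.choose (r i) a : ℝ))
    (Matrix.of fun i j : Fin q => ((Nat.factorial j * Nat.choose (a + j) a : ℕ) : ℝ)⁻¹ *
        (descPochhammer ℝ j).eval ((r i - a : ℕ) : ℝ))
  have h2 := Matrix.det_mul_row
    (fun j : Fin q => ((Nat.factorial j * Nat.choose (a + j) a : ℕ) : ℝ)⁻¹)
    (Matrix.of fun i j : Fin q => (descPochhammer ℝ j).eval ((r i - a : ℕ) : ℝ))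
  have h3 := Matrix.det_eval_matrixOfPolynomials_eq_det_vandermonde
    (fun i : Fin q => ((r i - a : ℕ) : ℝ)) (fun j => descPochhammer ℝ j)
    (fun j => descPochhammer_natDegree ℝ j) (fun j => monic_descPochhammer ℝ j)
  simp only [Matrix.of_apply] at h1 h2
  rw [h1, h2, ← h3, Matrix.det_vandermonde]
  refine mul_pos (Finset.prod_pos fun i _ => Nat.cast_pos.2 (Nat.choose_pos (ha i)))
    (mul_pos (Finset.prod_pos fun j _ => inv_pos.2 (Nat.cast_pos.2 (Nat.mul_pos
      (Nat.factorial_pos _) (Nat.choose_pos (Nat.le_add_right a j)))))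
    (Finset.prod_pos fun i _ => Finset.prod_pos fun j hj => ?_))
  have h4 := hr (Finset.mem_Ioi.1 hj)
  have h5 := ha i
  rw [sub_pos, Nat.cast_lt]
  omega

/-- The sign that a facet normal with number `x` and sign `b` contributes to a minor when it is the
row of index `i`; the columns of the minor start at `a`. -/
def minorSign (a : ℕ) (b : Bool) (x i : ℕ) : Bool := if x = a + i then b else decide (Odd x)

theorem sgn_decide_odd (x : ℕ) : sgn (decide (Odd x)) = (-1) ^ (x + 1) := by
  rcases Nat.even_or_odd x with h | h
  · simp [Nat.not_odd_iff_even.2 h, pow_succ, h.neg_one_pow]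
  · simp [h, pow_succ, h.neg_one_pow]

theorem facetCoeff_zero {b : Bool} {i : ℕ} (hi : 0 < i) (j : ℕ) :
    facetCoeff 0 b i j = sgn (decide (Odd i)) * (Nat.choose (i - 1) j : ℝ) := by
  rw [sgn_decide_odd, facetCoeff]
  split_ifs with h h'
  · rfl
  · rw [Nat.choose_eq_zero_of_lt (by omega)]; simp
  · rw [Nat.choose_eq_zero_of_lt (by omega)]; simp

theorem StrictMono.add_le_apply {q a : ℕ} {t : Fin q → ℕ} (ht : StrictMono t) (ha : ∀ i, a ≤ t i)
    (i : Fin q) : a + i ≤ t i := by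
  obtain ⟨k, hk⟩ := i
  induction k with
  | zero => simpa using ha ⟨0, hk⟩
  | succ k ih =>
    have h1 := ih (by omega)
    have h2 : t ⟨k, by omega⟩ < t ⟨k + 1, hk⟩ := ht (by rw [Fin.lt_def]; simp)
    simp only at h1 ⊢
    omega

/-- The sign of the minors of the matrix of facet normals for small `ε`. -/
theorem eventually_minor_pos {q : ℕ} (a : ℕ) (σ : Fin q → Bool) {t : Fin q → ℕ}
    (ht : StrictMono t) (ha : ∀ i, a ≤ t i) :
    ∀ᶠ ε in nhdsWithin (0 : ℝ) (Set.Ioi 0), 0 < (∏ i, sgn (minorSign a (σ i) (t i) i)) *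
      (Matrix.of fun i j : Fin q => facetCoeff ε (σ i) (t i) (a + j)).det := by
  induction q generalizing a with
  | zero => simp
  | succ q ih =>
  -- If the first row has number `a`, it is `(±ε, 0, …, 0)` and can be expanded off. Otherwise every
  -- row lies strictly past its diagonal place, and the minor at `ε = 0` is already a nonzero Pascal
  -- minor up to row signs, so continuity suffices.
  rcases (ha 0).eq_or_lt with h0 | h0
  · have h1 := ih (a + 1) (σ ∘ Fin.succ) (t := t ∘ Fin.succ) (ht.comp (Fin.strictMono_succ))
      fun i => by
        have := StrictMono.add_le_apply ht ha i.succ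
        simp only [Function.comp_apply, Fin.val_succ] at this ⊢
        omega
    filter_upwards [h1, self_mem_nhdsWithin] with ε hε hpos
    have hpos' : 0 < ε := hpos
    rw [Matrix.det_succ_row_zero, Finset.sum_eq_single 0, Fin.prod_univ_succ]
    · have hsub : (Matrix.of fun i j : Fin (q + 1) => facetCoeff ε (σ i) (t i) (a + j)).submatrix
          Fin.succ (Fin.succAbove 0) = Matrix.of fun i j : Fin q =>
            facetCoeff ε ((σ ∘ Fin.succ) i) ((t ∘ Fin.succ) i) (a + 1 + j) := by
        ext i j
        simp [Nat.add_right_comm a 1, Nat.add_assoc]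
      rw [hsub]
      have hsgn : ∀ i : Fin q, minorSign a (σ i.succ) (t i.succ) i.succ =
          minorSign (a + 1) ((σ ∘ Fin.succ) i) ((t ∘ Fin.succ) i) i := by
        intro i
        simp [minorSign, Nat.add_right_comm a 1, Nat.add_assoc]
      simp only [hsgn]
      have hs0 : minorSign a (σ 0) (t 0) (0 : Fin (q + 1)) = σ 0 := by simp [minorSign, h0]
      rw [hs0]
      have hc0 : (Matrix.of fun i j : Fin (q + 1) => facetCoeff ε (σ i) (t i) (a + j)) 0 0 =
          sgn (σ 0) * ε := by
        rw [Matrix.of_apply, Fin.val_zero, add_zero, ← h0, facetCoeff_self]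
      rw [hc0]
      have := mul_pos hpos' hε
      have h2 := sgn_mul_self (σ 0)
      calc _ < _ := this
        _ = (sgn (σ 0) * sgn (σ 0)) * (ε * ((∏ i, sgn (minorSign (a + 1) ((σ ∘ Fin.succ) i)
          ((t ∘ Fin.succ) i) i)) * (Matrix.of fun i j : Fin q =>
            facetCoeff ε ((σ ∘ Fin.succ) i) ((t ∘ Fin.succ) i) (a + 1 + j)).det)) := by
            rw [h2, one_mul]
        _ = _ := by rw [Fin.val_zero, pow_zero]; ring
    · intro j _ hj
      have : (0 : ℕ) < j := Fin.pos_iff_ne_zero.2 hj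
      rw [Matrix.of_apply, ← h0, facetCoeff_of_lt _ (by omega)]
      ring
    · simp
  · have hlt : ∀ i, a + 1 ≤ t i := fun i => lt_of_lt_of_le h0 (ht.monotone (Fin.zero_le i))
    have hlt' : ∀ i : Fin (q + 1), a + i < t i := fun i => by
      have := StrictMono.add_le_apply ht hlt i
      omega
    have hsgn : ∀ i : Fin (q + 1), minorSign a (σ i) (t i) i = decide (Odd (t i)) :=
      fun i => if_neg (hlt' i).ne'
    simp only [hsgn]
    have hcont : Continuous fun ε : ℝ => (∏ i, sgn (decide (Odd (t i)))) *
        (Matrix.of fun i j : Fin (q + 1) => facetCoeff ε (σ i) (t i) (a + j)).det := by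
      refine continuous_const.mul (Continuous.matrix_det ?_)
      refine continuous_matrix fun i j => ?_
      simp only [Matrix.of_apply, facetCoeff]
      split_ifs <;> fun_prop
    refine (hcont.continuousAt.eventually (lt_mem_nhds ?_)).filter_mono nhdsWithin_le_nhds
    have h1 := Matrix.det_mul_column (fun i : Fin (q + 1) => sgn (decide (Odd (t i))))
      (Matrix.of fun i j : Fin (q + 1) => (Nat.choose (t i - 1) (a + j) : ℝ))
    simp only [Matrix.of_apply] at h1
    have h2 : (Matrix.of fun i j : Fin (q + 1) => facetCoeff 0 (σ i) (t i) (a + j)) =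
        Matrix.of fun i j : Fin (q + 1) => sgn (decide (Odd (t i))) * (Nat.choose (t i - 1) (a + j) : ℝ) := by
      ext i j
      rw [Matrix.of_apply, Matrix.of_apply, facetCoeff_zero (by have := hlt i; omega)]
    beta_reduce
    rw [h2, h1, ← mul_assoc, ← Finset.prod_mul_distrib]
    simp only [sgn_mul_self, Finset.prod_const_one, one_mul]
    refine det_choose_pos a (r := fun i => t i - 1) (fun i j hij => ?_) fun i => ?_
    · have h3 := ht hij
      have h4 := hlt i
      simp only
      omega
    · have h4 := hlt i
      omega

/-! ### Cramer's rule and the cubical Gale evenness condition -/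

section

variable {n d m : ℕ} {ε : ℝ}

section Cramer

variable {B : Fin (m + 1) → Fin m → ℝ}

/-- The minor of a matrix with one more row than columns that omits the row `k`. -/
def omitRowMinor (B : Fin (m + 1) → Fin m → ℝ) (k : Fin (m + 1)) : ℝ :=
  (Matrix.of fun i j : Fin m => B (k.succAbove i) j).det

/-- Repeat column `j` in front of the matrix and expand the vanishing determinant along it. -/
theorem sum_omitRowMinor_mul (B : Fin (m + 1) → Fin m → ℝ) (j : Fin m) :
    ∑ k : Fin (m + 1), ((-1) ^ (k : ℕ) * omitRowMinor B k) * B k j = 0 := by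
  have h1 := Matrix.det_zero_of_column_eq
    (M := Matrix.of fun i => (Fin.cons (B i j) (B i) : Fin (m + 1) → ℝ))
    (i := 0) (j := j.succ) (Fin.succ_ne_zero j).symm (fun k => by simp)
  rw [Matrix.det_succ_column_zero] at h1
  rw [← h1]
  refine Finset.sum_congr rfl fun k _ => ?_
  rw [Matrix.of_apply, Fin.cons_zero, mul_right_comm]
  congr 2

/-- Up to scaling there is only one dependence: the difference of the two sides is a dependence with
zero coefficient at row `0`, and the other rows are independent. -/
theorem mul_omitRowMinor_eq (hB : omitRowMinor B 0 ≠ 0) {μ : Fin (m + 1) → ℝ}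
    (hμ : ∀ j, ∑ k, μ k * B k j = 0) (k : Fin (m + 1)) :
    μ k * omitRowMinor B 0 = ((-1) ^ (k : ℕ) * omitRowMinor B k) * μ 0 := by
  let ν : Fin (m + 1) → ℝ := fun k =>
    μ k * omitRowMinor B 0 - ((-1) ^ (k : ℕ) * omitRowMinor B k) * μ 0
  have hν : ∀ j, ∑ k, ν k * B k j = 0 := by
    intro j
    have h1 : ∑ k, ν k * B k j = (∑ k, μ k * B k j) * omitRowMinor B 0 -
        (∑ k : Fin (m + 1), ((-1) ^ (k : ℕ) * omitRowMinor B k) * B k j) * μ 0 := by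
      rw [Finset.sum_mul, Finset.sum_mul, ← Finset.sum_sub_distrib]
      exact Finset.sum_congr rfl fun k _ => by ring
    rw [h1, hμ, sum_omitRowMinor_mul, zero_mul, zero_mul, sub_zero]
  have hν0 : ν 0 = 0 := by simp [ν]; ring
  have hz : (fun i : Fin m => ν i.succ) = 0 := by
    refine Matrix.eq_zero_of_vecMul_eq_zero hB ?_
    funext j
    have h1 := hν j
    rw [Fin.sum_univ_succ, hν0, zero_mul, zero_add] at h1
    exact h1
  refine sub_eq_zero.1 ?_
  change ν k = 0
  refine Fin.cases hν0 (fun i => congrFun hz i) k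

/-- A full set of nonzero maximal minors decides whether there is a positive dependence. -/
theorem exists_positive_dependence_iff (hB : ∀ k, omitRowMinor B k ≠ 0) :
    (∃ μ : Fin (m + 1) → ℝ, (∀ k, 0 < μ k) ∧ ∀ j, ∑ k, μ k * B k j = 0) ↔
      ∀ k : Fin m, omitRowMinor B k.castSucc * omitRowMinor B k.succ < 0 := by
  have hstep : ∀ k : Fin m, ((-1) ^ (k.castSucc : ℕ) * omitRowMinor B k.castSucc) *
      ((-1) ^ (k.succ : ℕ) * omitRowMinor B k.succ) =
      -(omitRowMinor B k.castSucc * omitRowMinor B k.succ) := by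
    intro k
    have : ((-1 : ℝ) ^ (k : ℕ)) * (-1) ^ (k : ℕ) = 1 := by
      rw [← mul_pow]; norm_num
    rw [Fin.val_castSucc, Fin.val_succ, pow_succ]
    linear_combination (-(omitRowMinor B k.castSucc * omitRowMinor B k.succ)) * this
  constructor
  · rintro ⟨μ, hpos, hμ⟩ k
    have key : ∀ k : Fin (m + 1), 0 < ((-1) ^ (k : ℕ) * omitRowMinor B k) * omitRowMinor B 0 := by
      intro k
      have h1 := mul_omitRowMinor_eq (hB 0) hμ k
      have h2 : 0 < omitRowMinor B 0 * omitRowMinor B 0 := mul_self_pos.2 (hB 0)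
      have h3 : ((-1) ^ (k : ℕ) * omitRowMinor B k) * omitRowMinor B 0 * μ 0 =
          μ k * (omitRowMinor B 0 * omitRowMinor B 0) := by
        linear_combination (-omitRowMinor B 0) * h1
      have h4 : 0 < ((-1) ^ (k : ℕ) * omitRowMinor B k) * omitRowMinor B 0 * μ 0 := by
        rw [h3]; exact mul_pos (hpos k) h2
      exact pos_of_mul_pos_left h4 (hpos 0).le
    have h5 := mul_pos (key k.castSucc) (key k.succ)
    have h6 : 0 < omitRowMinor B 0 * omitRowMinor B 0 := mul_self_pos.2 (hB 0)
    have h7 : 0 < -(omitRowMinor B k.castSucc * omitRowMinor B k.succ) := by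
      rw [← hstep]
      refine pos_of_mul_pos_left (b := omitRowMinor B 0 * omitRowMinor B 0) ?_ h6.le
      linarith
    linarith
  · intro h
    refine ⟨fun k => ((-1) ^ (k : ℕ) * omitRowMinor B k) * omitRowMinor B 0, fun k => ?_,
      fun j => ?_⟩
    · induction k using Fin.induction with
      | zero => simpa using mul_self_pos.2 (hB 0)
      | succ k ih =>
        have h1 : 0 < ((-1) ^ (k.castSucc : ℕ) * omitRowMinor B k.castSucc) *
            ((-1) ^ (k.succ : ℕ) * omitRowMinor B k.succ) := by rw [hstep]; linarith [h k]
        have h2 := mul_pos ih h1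
        refine pos_of_mul_pos_left (b := ((-1) ^ (k.castSucc : ℕ) * omitRowMinor B k.castSucc) *
          ((-1) ^ (k.castSucc : ℕ) * omitRowMinor B k.castSucc)) ?_ (mul_self_nonneg _)
        linarith
    · have := sum_omitRowMinor_mul B j
      calc _ = (∑ k : Fin (m + 1), ((-1) ^ (k : ℕ) * omitRowMinor B k) * B k j) *
          omitRowMinor B 0 := by
            rw [Finset.sum_mul]; exact Finset.sum_congr rfl fun k _ => by ring
        _ = 0 := by rw [this, zero_mul]

end Cramer

/-- The signs of all minors of truncated facet normals are the ones for small `ε`. -/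
def HasStableMinors (n m : ℕ) (ε : ℝ) : Prop :=
  ∀ (σ : Fin m → Bool) (t : Fin m → Fin n), StrictMono t →
    0 < (∏ i, sgn (minorSign 0 (σ i) (t i) i)) * (facetMatrix ε σ fun i => (t i : ℕ)).det

theorem eventually_hasStableMinors (n m : ℕ) :
    ∀ᶠ ε in nhdsWithin (0 : ℝ) (Set.Ioi 0), HasStableMinors n m ε := by
  refine Filter.eventually_all.2 fun σ => Filter.eventually_all.2 fun t => ?_
  rw [Filter.eventually_imp_distrib_left]
  intro ht
  have := eventually_minor_pos 0 σ (t := fun i => (t i : ℕ)) (fun i j hij => ht hij)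
    (fun _ => Nat.zero_le _)
  simpa only [zero_add, facetMatrix] using this

theorem HasStableMinors.inGeneralPosition (h : HasStableMinors n m ε) :
    InGeneralPosition n m ε :=
  fun σ t ht => (mul_ne_zero_iff.1 (h σ t ht).ne').2

/-- The cubical Gale evenness condition on the numbers `s i` and signs `σ i` of `p` facets, for facet
numbers that start at `a`. -/
def GaleEvenness {p : ℕ} (a : ℕ) (s : Fin p → ℕ) (σ : Fin p → Bool) : Prop :=
  ∀ i j : Fin p, (j : ℕ) = i + 1 → minorSign a (σ i) (s i) i = !decide (Odd (s j))

theorem sgn_mul_sgn_neg_iff (a b : Bool) : sgn a * sgn b < 0 ↔ a = !b := by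
  cases a <;> cases b <;> norm_num

/-- The two minors share all rows in equal positions except position `k`, which holds row `k + 1` in
one and row `k` in the other; all other signs cancel. Row `k + 1` in position `k` is past the
diagonal, so it contributes its parity. -/
theorem HasStableMinors.omitRowMinor_mul_neg_iff (h : HasStableMinors n m ε)
    {s : Fin (m + 1) → Fin n} (hs : StrictMono s) (σ : Fin (m + 1) → Bool) (k : Fin m) :
    omitRowMinor (fun i (j : Fin m) => facetCoeff ε (σ i) (s i) j) k.castSucc *
      omitRowMinor (fun i (j : Fin m) => facetCoeff ε (σ i) (s i) j) k.succ < 0 ↔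
    minorSign 0 (σ k.castSucc) (s k.castSucc) k = !decide (Odd (s k.succ : ℕ)) := by
  have hall : ∀ l : Fin (m + 1), 0 < (∏ i : Fin m, sgn (minorSign 0 (σ (l.succAbove i))
      (s (l.succAbove i)) i)) * omitRowMinor (fun i (j : Fin m) => facetCoeff ε (σ i) (s i) j) l :=
    fun l => h (fun i => σ (l.succAbove i)) (fun i => s (l.succAbove i))
      (hs.comp (Fin.strictMono_succAbove l))
  have h3 := mul_pos (hall k.castSucc) (hall k.succ)
  have hprod : (∏ i : Fin m, sgn (minorSign 0 (σ (k.castSucc.succAbove i))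
      (s (k.castSucc.succAbove i)) i)) * (∏ i : Fin m, sgn (minorSign 0 (σ (k.succ.succAbove i))
      (s (k.succ.succAbove i)) i)) = sgn (minorSign 0 (σ k.castSucc) (s k.castSucc) k) *
        sgn (decide (Odd (s k.succ : ℕ))) := by
    rw [← Finset.prod_mul_distrib, Finset.prod_eq_single k]
    · have hlt : (k : ℕ) + 1 ≤ s k.succ := by
        have := StrictMono.add_le_apply (t := fun i => (s i : ℕ)) (a := 0) (fun i j hij => hs hij)
          (fun _ => Nat.zero_le _) k.succ
        simpa using this
      have hk : minorSign 0 (σ k.succ) (s k.succ) k = decide (Odd (s k.succ : ℕ)) :=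
        if_neg (by omega)
      rw [Fin.succAbove_castSucc_self, Fin.succAbove_succ_self, hk, mul_comm]
    · intro i _ hik
      have : k.castSucc.succAbove i = k.succ.succAbove i := by
        rcases lt_or_gt_of_ne hik with hlt | hlt
        · rw [Fin.succAbove_of_castSucc_lt _ _ (by simpa using hlt),
            Fin.succAbove_of_castSucc_lt _ _ (by
              rw [Fin.lt_def] at hlt ⊢; simp; omega)]
        · rw [Fin.succAbove_of_le_castSucc _ _ (by simpa using hlt.le),
            Fin.succAbove_of_le_castSucc _ _ (by
              rw [Fin.lt_def] at hlt; rw [Fin.le_def]; simp; omega)]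
      rw [this, sgn_mul_self]
    · simp
  rw [← sgn_mul_sgn_neg_iff, ← hprod]
  rw [mul_mul_mul_comm] at h3
  constructor
  · intro h4
    by_contra h5
    exact absurd h3 (not_lt.2 (mul_nonpos_of_nonneg_of_nonpos (not_lt.1 h5) h4.le))
  · intro h4
    by_contra h5
    exact absurd h3 (not_lt.2 (mul_nonpos_of_nonpos_of_nonneg h4.le (not_lt.1 h5)))

/-- The partial sign vector with sign `σ k` at `s k`. -/
def signVector (n : ℕ) {p : ℕ} (s : Fin p → ℕ) (σ : Fin p → Bool) : Fin n → Option Bool :=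
  fun i => Function.extend s (fun k => some (σ k)) (fun _ => none) (i : ℕ)

theorem signVector_apply {p : ℕ} {s : Fin p → ℕ} (hs : StrictMono s) (σ : Fin p → Bool)
    {i : Fin n} {k : Fin p} (hk : s k = i) : signVector n s σ i = some (σ k) := by
  rw [signVector, ← hk, hs.injective.extend_apply]

theorem signVector_apply_of_notMem {p : ℕ} {s : Fin p → ℕ} {σ : Fin p → Bool} {i : Fin n}
    (hi : ∀ k, s k ≠ i) : signVector n s σ i = none :=
  Function.extend_apply' _ _ _ fun ⟨k, hk⟩ => hi k hk

theorem signVector_ne_none_iff {p : ℕ} {s : Fin p → ℕ} (hs : StrictMono s) {σ : Fin p → Bool}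
    {i : Fin n} : signVector n s σ i ≠ none ↔ ∃ k, s k = i := by
  constructor
  · intro h
    by_contra! h'
    exact h (signVector_apply_of_notMem h')
  · rintro ⟨k, hk⟩
    simp [signVector_apply hs σ hk]

theorem HasStableMinors.hasPositiveDependence_iff (h : HasStableMinors n m ε)
    {s : Fin (m + 1) → ℕ} (hs : StrictMono s) (hn : ∀ i, s i < n) (σ : Fin (m + 1) → Bool) :
    HasPositiveDependence m ε (signVector n s σ) ↔ GaleEvenness 0 s σ := by
  let s' : Fin (m + 1) → Fin n := fun i => ⟨s i, hn i⟩
  have hs' : StrictMono s' := fun i j hij => hs hij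
  have hw : ∀ k, signVector n s σ (s' k) = some (σ k) := fun k => signVector_apply hs σ rfl
  have hB : ∀ k, omitRowMinor (fun i (j : Fin m) => facetCoeff ε (σ i) (s' i) j) k ≠ 0 :=
    fun k => h.inGeneralPosition _ (fun i => s' (k.succAbove i))
      (hs'.comp (Fin.strictMono_succAbove k))
  have h1 : HasPositiveDependence m ε (signVector n s σ) ↔
      ∃ μ : Fin (m + 1) → ℝ, (∀ k, 0 < μ k) ∧
        ∀ j : Fin m, ∑ k, μ k * facetCoeff ε (σ k) (s' k) j = 0 := by
    have hsum : ∀ (μ : Fin n → ℝ), (∀ i, signVector n s σ i = none → μ i = 0) → ∀ j : ℕ,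
        ∑ k, μ (s' k) * facetCoeff ε (σ k) (s' k) j =
          ∑ i : Fin n, μ i * facetCoeff ε ((signVector n s σ i).getD true) i j := by
      intro μ h0 j
      refine Fintype.sum_of_injective s' hs'.injective _ _ (fun i hi => ?_) fun k => ?_
      · rw [h0 i (signVector_apply_of_notMem fun k hk => hi ⟨k, Fin.ext hk⟩), zero_mul]
      · rw [hw, Option.getD_some]
    constructor
    · rintro ⟨μ, h0, hpos, hdep⟩
      exact ⟨fun k => μ (s' k), fun k => hpos _ (by simp [hw]), fun j =>
        (hsum μ h0 j).trans (hdep j j.2)⟩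
    · rintro ⟨μ, hpos, hdep⟩
      have hμ : ∀ k, Function.extend s' μ 0 (s' k) = μ k := hs'.injective.extend_apply μ 0
      have h0 : ∀ i, signVector n s σ i = none → Function.extend s' μ 0 i = 0 := by
        intro i hi
        refine Function.extend_apply' _ _ _ ?_
        rintro ⟨k, rfl⟩
        simp [hw] at hi
      refine ⟨Function.extend s' μ 0, h0, fun i hi => ?_, fun j hj => ?_⟩
      · obtain ⟨k, hk⟩ := (signVector_ne_none_iff hs).1 hi
        have : i = s' k := Fin.ext hk.symm
        rw [this, hμ]
        exact hpos k
      · rw [← hsum _ h0]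
        simp only [hμ]
        exact hdep ⟨j, hj⟩
  rw [h1, exists_positive_dependence_iff hB]
  simp only [h.omitRowMinor_mul_neg_iff hs']
  constructor
  · intro hk i j hij
    have hi : (i : ℕ) < m := by omega
    have h2 := hk ⟨i, hi⟩
    have : (⟨i, hi⟩ : Fin m).succ = j := Fin.ext hij.symm
    rw [this] at h2
    exact h2
  · intro hG k
    exact hG k.castSucc k.succ (by simp)

/-- The pairs of facet numbers in `[a, n)` and signs that satisfy the cubical Gale evenness
condition. -/
def galeSet (a n p : ℕ) : Set ((Fin p → ℕ) × (Fin p → Bool)) :=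
  {x | StrictMono x.1 ∧ (∀ i, a ≤ x.1 i ∧ x.1 i < n) ∧ GaleEvenness a x.1 x.2}

theorem HasStableMinors.ncard_eq (h : HasStableMinors n m ε) :
    Set.ncard {w : Fin n → Option Bool | (signSupport w).card = m + 1 ∧
      HasPositiveDependence m ε w} = (galeSet 0 n (m + 1)).ncard := by
  symm
  refine Set.ncard_congr (fun x _ => signVector n x.1 x.2) ?_ ?_ ?_
  · rintro ⟨s, σ⟩ ⟨hs, hn, hG⟩
    refine ⟨?_, (h.hasPositiveDependence_iff hs (fun i => (hn i).2) σ).2 hG⟩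
    have : signSupport (signVector n s σ) =
        Finset.univ.image fun k => (⟨s k, (hn k).2⟩ : Fin n) := by
      ext i
      rw [mem_signSupport, signVector_ne_none_iff hs]
      simp [Fin.ext_iff]
    rw [this, Finset.card_image_of_injective _ fun a b hab => hs.injective (congrArg Fin.val hab)]
    simp
  · rintro ⟨s, σ⟩ ⟨s', σ'⟩ ⟨hs, hn, -⟩ ⟨hs', hn', -⟩ heq
    simp only at heq hs hs' hn hn'
    have hrange : ∀ {s s' : Fin (m + 1) → ℕ} {σ σ' : Fin (m + 1) → Bool}, StrictMono s →
        StrictMono s' → (∀ i, s i < n) → signVector n s σ = signVector n s' σ' →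
        Set.range s ⊆ Set.range s' := by
      rintro s s' σ σ' hs hs' hn heq _ ⟨k, rfl⟩
      refine (signVector_ne_none_iff hs' (σ := σ') (i := ⟨s k, hn k⟩)).1 ?_
      rw [← heq, signVector_ne_none_iff hs]
      exact ⟨k, rfl⟩
    have hss : s = s' := (StrictMono.range_inj hs hs').1
      ((hrange hs hs' (fun i => (hn i).2) heq).antisymm
        (hrange hs' hs (fun i => (hn' i).2) heq.symm))
    subst hss
    refine Prod.ext rfl (funext fun k => ?_)
    have := congrFun heq ⟨s k, (hn k).2⟩
    rw [signVector_apply hs σ rfl, signVector_apply hs σ' rfl] at this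
    exact Option.some.inj this
  · rintro w ⟨hw, hdep⟩
    let s := (signSupport w).orderEmbOfFin hw
    have hs : StrictMono fun k => (s k : ℕ) := fun i j hij => s.strictMono hij
    have heq : signVector n (fun k => (s k : ℕ)) (fun k => (w (s k)).getD true) = w := by
      funext i
      by_cases hi : w i = none
      · rw [signVector_apply_of_notMem, hi]
        intro k hk
        have := Finset.orderEmbOfFin_mem (signSupport w) hw k
        rw [mem_signSupport] at this
        exact this (by rw [← hi]; exact congrArg w (Fin.ext hk))
      · have : i ∈ Set.range s := by
          rw [Finset.range_orderEmbOfFin]; exact mem_signSupport.2 hi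
        obtain ⟨k, rfl⟩ := this
        rw [signVector_apply hs _ rfl]
        obtain ⟨b, hb⟩ := Option.ne_none_iff_exists'.1 hi
        simp [hb]
    refine ⟨⟨fun k => s k, fun k => (w (s k)).getD true⟩, ⟨hs, fun i => ⟨Nat.zero_le _, (s i).2⟩,
      ?_⟩, heq⟩
    rw [← heq] at hdep
    exact (h.hasPositiveDependence_iff hs (fun i => (s i).2) _).1 hdep

/-- All vertices of the deformed cube project to vertices. -/
theorem HasStableMinors.hasPositiveDependence_of_full (h : HasStableMinors n m ε) (hm : m + 2 ≤ n)
    {w : Fin n → Option Bool} (hw : ∀ i, w i ≠ none) : HasPositiveDependence m ε w := by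
  -- The last `m + 1` indices are consecutive, so parities alternate; since `m + 2 ≤ n`, none of
  -- them is in an initial block and the signs do not matter.
  have hgale : GaleEvenness 0 (fun k : Fin (m + 1) => n - (m + 1) + k)
      (fun k => (w ⟨n - (m + 1) + k, by omega⟩).getD true) := by
    intro i j hij
    have h1 : minorSign 0 ((w ⟨n - (m + 1) + i, by omega⟩).getD true) (n - (m + 1) + i) i =
      decide (Odd (n - (m + 1) + (i : ℕ))) := if_neg (by omega)
    have h2 : n - (m + 1) + (j : ℕ) = n - (m + 1) + (i : ℕ) + 1 := by omega
    simp only [h1, h2, Nat.odd_add_one, decide_not, Bool.not_not]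
  have hs : StrictMono fun k : Fin (m + 1) => n - (m + 1) + (k : ℕ) := fun i j hij =>
    Nat.add_lt_add_left hij _
  obtain ⟨μ, h0, hpos, hdep⟩ := (h.hasPositiveDependence_iff hs (fun i => by omega) _).2 hgale
  have hsign : ∀ i, signVector n (fun k : Fin (m + 1) => n - (m + 1) + (k : ℕ))
      (fun k => (w ⟨n - (m + 1) + k, by omega⟩).getD true) i ≠ none →
      (signVector n (fun k : Fin (m + 1) => n - (m + 1) + (k : ℕ))
      (fun k => (w ⟨n - (m + 1) + k, by omega⟩).getD true) i).getD true = (w i).getD true := by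
    intro i hi
    obtain ⟨k, hk⟩ := (signVector_ne_none_iff hs).1 hi
    rw [signVector_apply hs _ hk, Option.getD_some]
    congr 2
    exact Fin.ext hk
  have hdep' : ∀ j < m, ∑ i : Fin n, μ i * facetCoeff ε ((w i).getD true) i j = 0 := by
    intro j hj
    rw [← hdep j hj]
    refine Finset.sum_congr rfl fun i _ => ?_
    by_cases hi : signVector n (fun k : Fin (m + 1) => n - (m + 1) + (k : ℕ))
      (fun k => (w ⟨n - (m + 1) + k, by omega⟩).getD true) i = none
    · rw [h0 i hi]; simp
    · rw [hsign i hi]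
  let t : Fin m → Fin n := fun k => ⟨n - m + k, by omega⟩
  have ht : StrictMono t := fun i j hij => Nat.add_lt_add_left (Fin.lt_def.1 hij) _
  have hμt : ∀ k, 0 < μ (t k) := fun k => hpos _ ((signVector_ne_none_iff hs).2
    ⟨k.succ, by simp [t]; omega⟩)
  have hμ0 : ∀ i, 0 ≤ μ i := fun i => by
    by_cases hi : signVector n (fun k : Fin (m + 1) => n - (m + 1) + (k : ℕ))
      (fun k => (w ⟨n - (m + 1) + k, by omega⟩).getD true) i = none
    · exact (h0 i hi).ge
    · exact (hpos i hi).le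
  have hdet := h.inGeneralPosition (fun k => (w (t k)).getD true) t ht
  obtain ⟨ν, hν⟩ := (Matrix.vecMul_surjective_iff_isUnit.2 ((Matrix.isUnit_iff_isUnit_det _).2
    hdet.isUnit)) fun j => -∑ i : Fin n, facetCoeff ε ((w i).getD true) i j
  -- Giving every row weight `1` and correcting by `ν` on the last `m` rows yields a dependence. A
  -- large multiple of `μ`, positive on those rows, restores positivity.
  have hN : ∃ N : ℝ, 0 ≤ N ∧ ∀ k, 0 < N * μ (t k) + ν k + 1 := by
    refine ⟨∑ k, |ν k| / μ (t k), Finset.sum_nonneg fun k _ => div_nonneg (abs_nonneg _)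
      (hμt k).le, fun k => ?_⟩
    have h1 : |ν k| / μ (t k) ≤ ∑ k, |ν k| / μ (t k) := Finset.single_le_sum
      (f := fun k => |ν k| / μ (t k)) (fun k _ => div_nonneg (abs_nonneg _) (hμt k).le)
      (Finset.mem_univ k)
    rw [div_le_iff₀ (hμt k)] at h1
    linarith [neg_abs_le (ν k)]
  obtain ⟨N, hN0, hN⟩ := hN
  have hext : ∀ k, Function.extend t ν 0 (t k) = ν k := ht.injective.extend_apply ν 0
  refine ⟨fun i => N * μ i + Function.extend t ν 0 i + 1, fun i hi => absurd hi (hw i),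
    fun i _ => ?_, fun j hj => ?_⟩
  · by_cases hi : ∃ k, t k = i
    · obtain ⟨k, rfl⟩ := hi
      simp only [hext]; exact hN k
    · simp only [Function.extend_apply' _ _ _ hi]
      have := mul_nonneg hN0 (hμ0 i)
      simp only [Pi.zero_apply]
      linarith
  · have h1 : ∑ i : Fin n, Function.extend t ν 0 i * facetCoeff ε ((w i).getD true) i j =
        -∑ i : Fin n, facetCoeff ε ((w i).getD true) i j := by
      rw [← congrFun hν ⟨j, hj⟩]
      symm
      refine Fintype.sum_of_injective t ht.injective _ _ (fun i hi => ?_) fun k => ?_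
      · rw [Function.extend_apply' _ _ _ hi]; simp
      · rw [hext]; rfl
    simp only [add_mul, one_mul, Finset.sum_add_distrib, mul_assoc, ← Finset.mul_sum]
    rw [hdep' j hj, h1]
    ring

theorem HasStableMinors.ncard_full (h : HasStableMinors n m ε) (hm : m + 2 ≤ n) :
    Set.ncard {w : Fin n → Option Bool | (signSupport w).card = n ∧
      HasPositiveDependence m ε w} = 2 ^ n := by
  have h1 : {w : Fin n → Option Bool | (signSupport w).card = n ∧
      HasPositiveDependence m ε w} = Set.range fun (σ : Fin n → Bool) i => some (σ i) := by
    ext w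
    constructor
    · rintro ⟨hc, -⟩
      have h2 : signSupport w = Finset.univ := Finset.eq_univ_of_card _ (by simpa using hc)
      refine ⟨fun i => (w i).getD true, funext fun i => ?_⟩
      have h3 : i ∈ signSupport w := h2 ▸ Finset.mem_univ i
      obtain ⟨b, hb⟩ := Option.ne_none_iff_exists'.1 (mem_signSupport.1 h3)
      simp [hb]
    · rintro ⟨σ, rfl⟩
      exact ⟨by simp [signSupport], h.hasPositiveDependence_of_full hm fun i => by simp⟩
  rw [h1, ← Set.image_univ, Set.InjOn.ncard_image, Set.ncard_univ, Nat.card_eq_fintype_card]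
  · simp
  · intro σ _ τ _ heq
    exact funext fun i => Option.some.inj (congrFun heq i)

end

/-! ### Counting the solutions of Gale evenness -/

/-- Increasing sequences in `[a, n)` whose parities alternate, beginning with the parity of `a`. -/
def alternatingSet (a n p : ℕ) : Set (Fin p → ℕ) :=
  {s | StrictMono s ∧ (∀ i, a ≤ s i ∧ s i < n) ∧ ∀ i, Even (s i + (a + i))}

theorem finite_pi_lt (n p : ℕ) : {s : Fin p → ℕ | ∀ i, s i < n}.Finite := by
  have := Set.Finite.pi' (ι := Fin p) (fun _ => Set.finite_lt_nat n)
  exact this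

theorem finite_alternatingSet (a n p : ℕ) : (alternatingSet a n p).Finite :=
  (finite_pi_lt n p).subset fun _ hs i => (hs.2.1 i).2

theorem strictMono_cons {p : ℕ} {a : ℕ} {s : Fin p → ℕ} (hs : StrictMono s)
    (ha : ∀ i, a < s i) : StrictMono (Fin.cons a s : Fin (p + 1) → ℕ) := by
  intro i j hij
  induction j using Fin.cases with
  | zero => exact absurd hij (Fin.not_lt_zero i)
  | succ j =>
    induction i using Fin.cases with
    | zero => simpa using ha j
    | succ i => simpa using hs (Fin.succ_lt_succ_iff.1 hij)

/-- The first term is `a`, or by parity at least `a + 2`. On cardinalities this is Pascal's rule. -/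
theorem alternatingSet_succ {a n : ℕ} (p : ℕ) (h : a < n) : alternatingSet a n (p + 1) =
    (fun s : Fin p → ℕ => (Fin.cons a s : Fin (p + 1) → ℕ)) '' alternatingSet (a + 1) n p ∪
      alternatingSet (a + 2) n (p + 1) := by
  ext s
  constructor
  · rintro ⟨hs, hb, he⟩
    rcases (hb 0).1.eq_or_lt with h0 | h0
    · left
      refine ⟨fun i => s i.succ, ⟨fun i j hij => hs (Fin.succ_lt_succ_iff.2 hij), fun i =>
        ⟨?_, (hb i.succ).2⟩, fun i => ?_⟩, ?_⟩
      · have := hs (Fin.succ_pos i)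
        simp only
        omega
      · have := he i.succ
        rw [Fin.val_succ] at this
        rwa [add_assoc, add_comm 1]
      · funext i
        exact Fin.cases (by simpa using h0) (fun i => by simp) i
    · right
      have h2 : a + 2 ≤ s 0 := by
        have := he 0
        rw [Fin.val_zero, Nat.even_iff] at this
        omega
      refine ⟨hs, fun i => ⟨h2.trans (hs.monotone (Fin.zero_le i)), (hb i).2⟩, fun i => ?_⟩
      have := he i
      rw [Nat.even_iff] at this ⊢
      omega
  · rintro (⟨s, ⟨hs, hb, he⟩, rfl⟩ | ⟨hs, hb, he⟩)
    · refine ⟨strictMono_cons hs fun i => (hb i).1, fun i => ?_, fun i => ?_⟩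
      · exact Fin.cases (by simpa using h) (fun i => by
          have := hb i; simp; omega) i
      · exact Fin.cases (by simp) (fun i => by
          have := he i
          rw [Nat.even_iff] at this ⊢
          simp
          omega) i
    · refine ⟨hs, fun i => ⟨by have := (hb i).1; omega, (hb i).2⟩, fun i => ?_⟩
      have := he i
      rw [Nat.even_iff] at this ⊢
      omega

theorem ncard_alternatingSet_zero (a n : ℕ) : (alternatingSet a n 0).ncard = 1 := by
  have : alternatingSet a n 0 = Set.univ := by
    ext s
    simp [alternatingSet, Subsingleton.strictMono]
  rw [this, Set.ncard_univ]
  simp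

theorem alternatingSet_of_le {a n : ℕ} (p : ℕ) (h : n ≤ a) : alternatingSet a n (p + 1) = ∅ := by
  ext s
  simp only [Set.mem_empty_iff_false, iff_false]
  intro hs
  have := hs.2.1 0
  omega

theorem ncard_alternatingSet_succ {a n : ℕ} (p : ℕ) (h : a < n) :
    (alternatingSet a n (p + 1)).ncard =
      (alternatingSet (a + 1) n p).ncard + (alternatingSet (a + 2) n (p + 1)).ncard := by
  rw [alternatingSet_succ p h, Set.ncard_union_eq _ ((finite_alternatingSet _ _ _).image _)
    (finite_alternatingSet _ _ _), Set.InjOn.ncard_image]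
  · intro s _ s' _ heq
    exact (Fin.cons_inj.1 heq).2
  · rw [Set.disjoint_left]
    rintro _ ⟨s, -, rfl⟩ hs
    have := (hs.2.1 0).1
    simp at this

theorem ncard_alternatingSet (a N p : ℕ) :
    (alternatingSet a (a + N) p).ncard = Nat.choose ((N + p) / 2) p := by
  induction N using Nat.strong_induction_on generalizing a p with
  | _ N ih =>
  rcases p with _ | p
  · simp [ncard_alternatingSet_zero]
  match N, ih with
  | 0, _ =>
    rw [alternatingSet_of_le p (by omega), Set.ncard_empty, Nat.choose_eq_zero_of_lt (by omega)]
  | 1, ih =>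
    rw [ncard_alternatingSet_succ p (by omega), alternatingSet_of_le (a := a + 2) p (by omega),
      ih 0 (by omega) (a + 1) p, Set.ncard_empty]
    have : (1 + (p + 1)) / 2 = (0 + p) / 2 + 1 := by omega
    have h0 : Nat.choose ((0 + p) / 2) (p + 1) = 0 := Nat.choose_eq_zero_of_lt (by omega)
    rw [this, Nat.choose_succ_succ', h0]
  | N + 2, ih =>
    have h1 := ih (N + 1) (by omega) (a + 1) p
    have h2 := ih N (by omega) (a + 2) (p + 1)
    rw [show a + 1 + (N + 1) = a + (N + 2) by omega] at h1
    rw [show a + 2 + N = a + (N + 2) by omega] at h2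
    rw [ncard_alternatingSet_succ p (by omega), h1, h2,
      show (N + 2 + (p + 1)) / 2 = (N + 1 + p) / 2 + 1 by omega, Nat.choose_succ_succ,
      show (N + (p + 1)) / 2 = (N + 1 + p) / 2 by omega]

/-- Increasing sequences in `[a, n)` whose parities alternate. -/
def alternatingSet' (a n p : ℕ) : Set (Fin p → ℕ) :=
  {s | StrictMono s ∧ (∀ i, a ≤ s i ∧ s i < n) ∧
    ∀ i j : Fin p, (j : ℕ) = i + 1 → decide (Odd (s i)) = !decide (Odd (s j))}

theorem alternatingSet'_eq (a n p : ℕ) : alternatingSet' a n (p + 1) =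
    alternatingSet a n (p + 1) ∪ alternatingSet (a + 1) n (p + 1) := by
  have hodd : ∀ x y : ℕ, decide (Odd x) = (!decide (Odd y)) ↔ (x + y) % 2 = 1 := by
    intro x y
    rw [← decide_not, decide_eq_decide, Nat.not_odd_iff, Nat.odd_iff]
    omega
  ext s
  constructor
  · rintro ⟨hs, hb, halt⟩
    have key : ∀ i : Fin (p + 1), (s i + (s 0 + i)) % 2 = 0 := by
      intro i
      induction i using Fin.induction with
      | zero => rw [Fin.val_zero]; omega
      | succ i ih =>
        have := (hodd _ _).1 (halt i.castSucc i.succ (by simp))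
        rw [Fin.val_castSucc] at ih
        rw [Fin.val_succ]
        omega
    rcases Nat.mod_two_eq_zero_or_one (s 0 + a) with h0 | h0
    · left
      refine ⟨hs, hb, fun i => ?_⟩
      have := key i
      rw [Nat.even_iff]
      omega
    · right
      refine ⟨hs, fun i => ⟨?_, (hb i).2⟩, fun i => ?_⟩
      · have h1 := (hb 0).1
        have h2 := hs.monotone (Fin.zero_le i)
        omega
      · have := key i
        rw [Nat.even_iff]
        omega
  · rintro (⟨hs, hb, he⟩ | ⟨hs, hb, he⟩)
    · refine ⟨hs, hb, fun i j hij => (hodd _ _).2 ?_⟩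
      have h1 := he i
      have h2 := he j
      rw [Nat.even_iff] at h1 h2
      omega
    · refine ⟨hs, fun i => ⟨by have := (hb i).1; omega, (hb i).2⟩,
        fun i j hij => (hodd _ _).2 ?_⟩
      have h1 := he i
      have h2 := he j
      rw [Nat.even_iff] at h1 h2
      omega

theorem ncard_alternatingSet' (a N p : ℕ) : (alternatingSet' a (a + (N + 1)) (p + 1)).ncard =
    Nat.choose ((N + p) / 2 + 1) (p + 1) + Nat.choose ((N + p + 1) / 2) (p + 1) := by
  rw [alternatingSet'_eq, Set.ncard_union_eq _ (finite_alternatingSet _ _ _)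
    (finite_alternatingSet _ _ _), ncard_alternatingSet,
    show a + (N + 1) = a + 1 + N by omega, ncard_alternatingSet]
  · rw [show (N + 1 + (p + 1)) / 2 = (N + p) / 2 + 1 by omega, add_assoc]
  · rw [Set.disjoint_left]
    intro s h1 h2
    have h3 := h1.2.2 0
    have h4 := h2.2.2 0
    rw [Nat.even_iff] at h3 h4
    omega

theorem finite_galeSet (a n p : ℕ) : (galeSet a n p).Finite :=
  ((finite_pi_lt n p).prod (Set.toFinite Set.univ)).subset fun _ hx =>
    ⟨fun i => (hx.2.1 i).2, trivial⟩

theorem ncard_galeSet_one (a N : ℕ) : (galeSet a (a + N) 1).ncard = 2 * N := by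
  have : galeSet a (a + N) 1 = ((fun (x : ℕ) (_ : Fin 1) => x) '' Set.Ico a (a + N)) ×ˢ
      (Set.univ : Set (Fin 1 → Bool)) := by
    ext ⟨s, σ⟩
    constructor
    · rintro ⟨-, hb, -⟩
      exact ⟨⟨s 0, hb 0, funext fun i => by rw [Subsingleton.elim i 0]⟩, trivial⟩
    · rintro ⟨⟨x, hx, rfl⟩, -⟩
      refine ⟨Subsingleton.strictMono _, fun _ => hx, fun i j hij => ?_⟩
      omega
  rw [this, Set.ncard_prod, Set.InjOn.ncard_image (fun x _ y _ h => congrFun h 0)]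
  simp [Set.ncard_eq_toFinset_card', mul_comm]

/-- If the sequence starts at `a`, its first sign is forced by the parity of the second term and the
tail is a Gale set from `a + 1`. If it starts later, there is no initial block: parities alternate
and all signs are free. -/
theorem galeSet_succ_succ {a n : ℕ} (p : ℕ) (h : a < n) : galeSet a n (p + 2) =
    (fun x : (Fin (p + 1) → ℕ) × (Fin (p + 1) → Bool) =>
      ((Fin.cons a x.1, Fin.cons (!decide (Odd (x.1 0))) x.2) :
        (Fin (p + 2) → ℕ) × (Fin (p + 2) → Bool))) '' galeSet (a + 1) n (p + 1) ∪
      alternatingSet' (a + 1) n (p + 2) ×ˢ Set.univ := by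
  have hshift : ∀ b x i, minorSign (a + 1) b x i = minorSign a b x (i + 1) := by
    intro b x i
    rw [minorSign, minorSign, Nat.add_right_comm a 1, Nat.add_assoc]
  ext ⟨s, σ⟩
  constructor
  · rintro ⟨hs, hb, hG⟩
    rcases (hb 0).1.eq_or_lt with h0 | h0
    · left
      refine ⟨(fun i => s i.succ, fun i => σ i.succ), ⟨fun i j hij =>
        hs (Fin.succ_lt_succ_iff.2 hij), fun i => ⟨?_, (hb i.succ).2⟩, fun i j hij => ?_⟩, ?_⟩
      · have := hs (Fin.succ_pos i)
        simp only at this h0 ⊢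
        omega
      · rw [hshift]
        exact hG i.succ j.succ (by simp [hij])
      · refine Prod.ext (funext fun i => ?_) (funext fun i => ?_)
        · exact Fin.cases (by simpa using h0) (fun i => by simp) i
        · have h1 := hG 0 1 (by simp)
          rw [minorSign, if_pos (by simpa using h0.symm)] at h1
          exact Fin.cases h1.symm (fun i => by simp) i
    · right
      refine ⟨⟨hs, fun i => ⟨?_, (hb i).2⟩, fun i j hij => ?_⟩, trivial⟩
      · have := hs.monotone (Fin.zero_le i)
        simp only at this h0 ⊢
        omega
      · rw [← hG i j hij, minorSign, if_neg]
        have := StrictMono.add_le_apply (a := a + 1) hs (fun i => by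
          have := hs.monotone (Fin.zero_le i)
          simp only at this h0 ⊢
          omega) i
        simp only at this ⊢
        omega
  · rintro (⟨⟨s, σ⟩, ⟨hs, hb, hG⟩, heq⟩ | ⟨⟨hs, hb, hG⟩, -⟩)
    · rw [← heq]
      refine ⟨strictMono_cons hs fun i => (hb i).1, fun i => ?_, fun i j hij => ?_⟩
      · exact Fin.cases (by simpa using h) (fun i => by
          have := hb i; simp only [Fin.cons_succ] at this ⊢; omega) i
      · induction j using Fin.cases with
        | zero => simp at hij
        | succ j =>
        induction i using Fin.cases with
        | zero =>
          have : j = 0 := Fin.ext (by simpa using hij)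
          subst this
          simp [minorSign]
        | succ i =>
          have := hG i j (by simpa using hij)
          rw [hshift] at this
          simpa using this
    · refine ⟨hs, fun i => ⟨by have := (hb i).1; simp only at this ⊢; omega, (hb i).2⟩,
        fun i j hij => ?_⟩
      rw [← hG i j hij, minorSign, if_neg]
      have := StrictMono.add_le_apply (a := a + 1) hs (fun i => (hb i).1) i
      simp only at this ⊢
      omega

/-- Removing an initial term lowers both the interval length and the sequence length by one, so `d`
is preserved. Each step adds one summand, the factor `2 ^ q` counting free signs; a single row
leaves `2 * d`. -/
theorem ncard_galeSet (a d p : ℕ) (hd : 1 ≤ d) : (galeSet a (a + (p + d)) (p + 1)).ncard =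
    2 * d + ∑ q ∈ Finset.Icc 2 (p + 1),
      (Nat.choose (d / 2 + q - 1) q + Nat.choose ((d - 1) / 2 + q - 1) q) * 2 ^ q := by
  induction p generalizing a with
  | zero => simp [ncard_galeSet_one]
  | succ p ih =>
    have h1 := ih (a + 1)
    rw [show a + 1 + (p + d) = a + (p + 1 + d) by omega] at h1
    have h2 := ncard_alternatingSet' (a + 1) (p + d - 1) (p + 1)
    rw [show a + 1 + (p + d - 1 + 1) = a + (p + 1 + d) by omega] at h2
    have hsum := Finset.sum_Icc_succ_top (a := 2) (b := p + 1) (by omega) fun q =>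
      (Nat.choose (d / 2 + q - 1) q + Nat.choose ((d - 1) / 2 + q - 1) q) * 2 ^ q
    rw [galeSet_succ_succ p (by omega), Set.ncard_union_eq _ ((finite_galeSet _ _ _).image _)
      (((finite_pi_lt _ _).subset fun s hs i => (hs.2.1 i).2).prod (Set.toFinite _)),
      Set.InjOn.ncard_image, h1, Set.ncard_prod, h2, hsum,
      Set.ncard_univ, Nat.card_eq_fintype_card,
      show (p + d - 1 + (p + 1)) / 2 + 1 = d / 2 + (p + 1 + 1) - 1 by omega,
      show (p + d - 1 + (p + 1) + 1) / 2 = (d - 1) / 2 + (p + 1 + 1) - 1 by omega]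
    · simp [add_assoc]
    · rintro ⟨s, σ⟩ _ ⟨s', σ'⟩ _ heq
      simp only [Prod.mk.injEq, Fin.cons_inj] at heq
      exact Prod.ext heq.1.2 heq.2.2
    · rw [Set.disjoint_left]
      rintro _ ⟨x, -, rfl⟩ ⟨hx, -⟩
      have := (hx.2.1 0).1
      simp at this

/-! ### Face numbers and their closed forms -/

theorem exists_hasStableMinors (n m : ℕ) :
    ∃ ε₀ : ℝ, 0 < ε₀ ∧ ∀ ε : ℝ, 0 < ε → ε < ε₀ → ε ≤ 1 ∧ HasStableMinors n m ε := by
  obtain ⟨δ, hδ, h⟩ := (mem_nhdsGT_iff_exists_Ioo_subset).1 (eventually_hasStableMinors n m)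
  exact ⟨min δ 1, lt_min hδ one_pos, fun ε h0 h1 =>
    ⟨(h1.trans_le (min_le_right _ _)).le, h ⟨h0, h1.trans_le (min_le_left _ _)⟩⟩⟩

theorem HasStableMinors.numFaces_facets {n d : ℕ} {ε : ℝ} (h : d ≤ n) (hd : 1 ≤ d) (hε : 0 < ε)
    (hε1 : ε ≤ 1) (hs : HasStableMinors n (n - d) ε) :
    numFaces (d - 1) (neighborlyCubical h ε) = 2 * d + ∑ p ∈ Finset.Icc 2 (n - d + 1),
      (Nat.choose (d / 2 + p - 1) p + Nat.choose ((d - 1) / 2 + p - 1) p) * 2 ^ p := by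
  rw [hs.inGeneralPosition.numFaces_eq h hε hε1 (by omega),
    show n - (d - 1) = n - d + 1 by omega, hs.ncard_eq]
  have := ncard_galeSet 0 d (n - d) hd
  rwa [show 0 + (n - d + d) = n by omega] at this

theorem HasStableMinors.numFaces_vertices {n d : ℕ} {ε : ℝ} (h : d ≤ n) (hd : 2 ≤ d) (hε : 0 < ε)
    (hε1 : ε ≤ 1) (hs : HasStableMinors n (n - d) ε) :
    numFaces 0 (neighborlyCubical h ε) = 2 ^ n := by
  rw [hs.inGeneralPosition.numFaces_eq h hε hε1 (by omega), Nat.sub_zero,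
    hs.ncard_full (by omega)]

theorem sum_facets_shift (d N : ℕ) (hd : 1 ≤ d) : ∑ p ∈ Finset.Icc 2 (N + 1),
      (Nat.choose (d / 2 + p - 1) p + Nat.choose ((d - 1) / 2 + p - 1) p) * 2 ^ p =
    4 * ∑ p ∈ Finset.range N,
      (Nat.choose (d / 2 + p + 1) (p + 2) + Nat.choose ((d + 1) / 2 + p) (p + 2)) * 2 ^ p := by
  induction N with
  | zero => simp
  | succ N ih =>
    rw [Finset.sum_Icc_succ_top (by omega), ih, Finset.sum_range_succ,
      show d / 2 + (N + 1 + 1) - 1 = d / 2 + N + 1 by omega,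
      show (d - 1) / 2 + (N + 1 + 1) - 1 = (d + 1) / 2 + N by omega]
    ring

/-- The second binomial is `(k - 1) / (p + k - 1)` times the first. -/
theorem choose_add_choose_even (k p : ℕ) (hk : 1 ≤ k) (hp : 2 ≤ p) :
    ((Nat.choose (k + p - 1) p + Nat.choose ((2 * k - 1) / 2 + p - 1) p : ℕ) : ℚ) =
      ((p : ℚ) + 2 * (k : ℚ) - 2) / ((p : ℚ) + (k : ℚ) - 1) * (Nat.choose (k + p - 1) p : ℚ) := by
  obtain ⟨k, rfl⟩ := Nat.exists_eq_add_of_le' hk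
  have h1 := Nat.choose_mul_succ_eq (k + p - 1) p
  rw [show k + p - 1 + 1 = k + p by omega, show k + p - p = k by omega] at h1
  rw [show (2 * (k + 1) - 1) / 2 + p - 1 = k + p - 1 by omega,
    show k + 1 + p - 1 = k + p by omega]
  have h2 : ((Nat.choose (k + p - 1) p * (k + p) : ℕ) : ℚ) = ((k + p).choose p * k : ℕ) := by
    rw [h1]
  have h3 : (0 : ℚ) < p := by exact_mod_cast (by omega : 0 < p)
  have h4 : (p : ℚ) + k ≠ 0 := by positivity
  push_cast at h2 ⊢
  rw [show (p : ℚ) + (k + 1) - 1 = p + k by ring, show (p : ℚ) + 2 * (k + 1) - 2 = p + 2 * k by ring]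
  field_simp
  linarith

/-- The summand is `(p + 2) * 2 ^ p = (p + 1) * 2 ^ (p + 1) - p * 2 ^ p`, so the sum telescopes. -/
theorem sum_facets_four (N : ℕ) : 2 * 4 + ∑ p ∈ Finset.Icc 2 (N + 1),
    (Nat.choose (4 / 2 + p - 1) p + Nat.choose ((4 - 1) / 2 + p - 1) p) * 2 ^ p =
      (N + 2) * 2 ^ (N + 2) := by
  induction N with
  | zero => simp
  | succ N ih =>
    rw [Finset.sum_Icc_succ_top (by omega), ← add_assoc, ih]
    have h1 : Nat.choose (4 / 2 + (N + 1 + 1) - 1) (N + 1 + 1) = N + 3 := by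
      rw [show 4 / 2 + (N + 1 + 1) - 1 = (N + 2) + 1 by omega]
      exact Nat.choose_succ_self_right (N + 2)
    have h2 : Nat.choose ((4 - 1) / 2 + (N + 1 + 1) - 1) (N + 1 + 1) = 1 := by
      rw [show (4 - 1) / 2 + (N + 1 + 1) - 1 = N + 1 + 1 by omega, Nat.choose_self]
    rw [h1, h2]
    ring

theorem HasStableMinors.numFaces_three {n : ℕ} {ε : ℝ} (hn : 4 ≤ n) (hε : 0 < ε)
    (hε1 : ε ≤ 1) (hs : HasStableMinors n (n - 4) ε) :
    numFaces 3 (neighborlyCubical hn ε) = (n - 2) * 2 ^ (n - 2) := by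
  rw [show (3 : ℕ) = 4 - 1 from rfl, hs.numFaces_facets hn (by norm_num) hε hε1,
    sum_facets_four, show n - 4 + 2 = n - 2 by omega]

theorem facet_vertex_ratio (n : ℕ) (hn : 4 ≤ n) :
    (((n - 2) * 2 ^ (n - 2) : ℕ) : ℝ) / ((2 ^ n : ℕ) : ℝ) = ((n : ℝ) - 2) / 4 := by
  obtain ⟨k, rfl⟩ := Nat.exists_eq_add_of_le' hn
  rw [show k + 4 - 2 = k + 2 by omega]
  push_cast
  rw [pow_add, pow_add]
  have : (2 : ℝ) ^ k ≠ 0 := by positivity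
  field_simp
  ring

end CubicalPolytope

end

theorem mainTheorem3 :
    (∀ (n d : ℕ) (hdn : d ≤ n), 2 ≤ d →
      ∃ ε₀ : ℝ, 0 < ε₀ ∧ ∀ ε : ℝ, 0 < ε → ε < ε₀ →
        CubicalPolytope.IsCubicalPolytope d (CubicalPolytope.neighborlyCubical hdn ε) ∧
        CubicalPolytope.numFaces (d - 1) (CubicalPolytope.neighborlyCubical hdn ε) =
          2 * d + 4 * ∑ p ∈ Finset.range (n - d),
            (Nat.choose (d / 2 + p + 1) (p + 2) + Nat.choose ((d + 1) / 2 + p) (p + 2)) * 2 ^ p ∧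
        CubicalPolytope.numFaces (d - 1) (CubicalPolytope.neighborlyCubical hdn ε) =
          2 * d + ∑ p ∈ Finset.Icc 2 (n - d + 1),
            (Nat.choose (d / 2 + p - 1) p + Nat.choose ((d - 1) / 2 + p - 1) p) * 2 ^ p ∧
        (∀ k : ℕ, d = 2 * k →
          (CubicalPolytope.numFaces (d - 1) (CubicalPolytope.neighborlyCubical hdn ε) : ℚ) =
            2 * (d : ℚ) + ∑ p ∈ Finset.Icc 2 (n - d + 1),
              ((p : ℚ) + 2 * (k : ℚ) - 2) / ((p : ℚ) + (k : ℚ) - 1) *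
                (Nat.choose (k + p - 1) p : ℚ) * 2 ^ p) ∧
        (∀ k : ℕ, d = 2 * k + 1 →
          CubicalPolytope.numFaces (d - 1) (CubicalPolytope.neighborlyCubical hdn ε) =
            2 * d + ∑ p ∈ Finset.Icc 2 (n - d + 1), Nat.choose (k + p - 1) p * 2 ^ (p + 1))) ∧
    (∀ (n : ℕ) (hn : 4 ≤ n),
      ∃ ε₀ : ℝ, 0 < ε₀ ∧ ∀ ε : ℝ, 0 < ε → ε < ε₀ →
        CubicalPolytope.numFaces 0 (CubicalPolytope.neighborlyCubical hn ε) = 2 ^ n ∧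
        CubicalPolytope.numFaces 3 (CubicalPolytope.neighborlyCubical hn ε) =
          (n - 2) * 2 ^ (n - 2) ∧
        (CubicalPolytope.numFaces 3 (CubicalPolytope.neighborlyCubical hn ε) : ℝ) /
            (CubicalPolytope.numFaces 0 (CubicalPolytope.neighborlyCubical hn ε) : ℝ) =
          Real.logb 2
            ((CubicalPolytope.numFaces 0 (CubicalPolytope.neighborlyCubical hn ε) : ℝ) / 4) / 4) ∧
    (∀ R : ℝ, ∃ P : Set (Fin 4 → ℝ), CubicalPolytope.IsCubicalPolytope 4 P ∧
      R < (CubicalPolytope.numFaces 3 P : ℝ) / (CubicalPolytope.numFaces 0 P : ℝ)) := by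
  refine ⟨fun n d hdn hd => ?_, fun n hn => ?_, fun R => ?_⟩
  · obtain ⟨ε₀, hpos, H⟩ := CubicalPolytope.exists_hasStableMinors n (n - d)
    refine ⟨ε₀, hpos, fun ε h0 h1 => ?_⟩
    obtain ⟨hε1, hs⟩ := H ε h0 h1
    have hf := hs.numFaces_facets hdn (by omega) h0 hε1
    refine ⟨hs.inGeneralPosition.isCubicalPolytope hdn h0 hε1, ?_, hf, fun k hk => ?_,
      fun k hk => ?_⟩
    · rw [hf, CubicalPolytope.sum_facets_shift d (n - d) (by omega)]
    · rw [hf]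
      push_cast
      congr 1
      refine Finset.sum_congr rfl fun p hp => ?_
      have h2 := CubicalPolytope.choose_add_choose_even k p (by omega) (Finset.mem_Icc.1 hp).1
      rw [← h2, hk, show 2 * k / 2 = k by omega]
      push_cast
      rfl
    · rw [hf]
      congr 1
      refine Finset.sum_congr rfl fun p _ => ?_
      rw [show d / 2 = k by omega, show (d - 1) / 2 = k by omega]
      ring
  · obtain ⟨ε₀, hpos, H⟩ := CubicalPolytope.exists_hasStableMinors n (n - 4)
    refine ⟨ε₀, hpos, fun ε h0 h1 => ?_⟩
    obtain ⟨hε1, hs⟩ := H ε h0 h1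
    have hv := hs.numFaces_vertices hn (by norm_num) h0 hε1
    have hf := hs.numFaces_three hn h0 hε1
    refine ⟨hv, hf, ?_⟩
    rw [hv, hf, CubicalPolytope.facet_vertex_ratio n hn]
    have : ((2 ^ n : ℕ) : ℝ) / 4 = (2 : ℝ) ^ ((n : ℝ) - 2) := by
      rw [Real.rpow_sub (by norm_num), Real.rpow_natCast]
      norm_num
    rw [this, Real.logb_rpow (by norm_num) (by norm_num)]
  -- With `n = N + 4` the ratio is `(N + 2) / 4`, which exceeds `R`.
  · obtain ⟨N, hN⟩ := exists_nat_gt (4 * R)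
    have hn : 4 ≤ N + 4 := by omega
    obtain ⟨ε₀, hpos, H⟩ := CubicalPolytope.exists_hasStableMinors (N + 4) (N + 4 - 4)
    obtain ⟨hε1, hs⟩ := H (ε₀ / 2) (half_pos hpos) (half_lt_self hpos)
    refine ⟨_, hs.inGeneralPosition.isCubicalPolytope hn (half_pos hpos) hε1, ?_⟩
    rw [hs.numFaces_vertices hn (by norm_num) (half_pos hpos) hε1,
      hs.numFaces_three hn (half_pos hpos) hε1, CubicalPolytope.facet_vertex_ratio _ hn]
    push_cast
    linarith
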